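/- Let $R=(r_n)_{n\in\mathbb N}$ be a strictly increasing sequence of integers, with $S(r_n)=r_{n+1}$, $S^{-1}(r_{n+1})=r_n$ and $S^{-1}(r_0)=r_0$. An operator is an expression $A(x)=\sum_{i=-n}^{m} z_iS^i(x)$ with $z_i\in\mathbb Z$; $A>_{ae}B$ means that $A(a)>B(a)$ for all but finitely many $a\in R$, and $<_{ae}$, $=_{ae}$ are defined similarly. Assume that $R$ is almost sparse, i.e. (i) for any operators $A,B$ one of $A>_{ae}B$, $A<_{ae}B$, $A=_{ae}B$ holds, and (ii) whenever $A>_{ae}B$ there is an integer $\Delta\ge 0$ with $A(S^\Delta(x))>_{ae}B(S^\Delta(x))+x$. Define $\emptyset$-definable functions on $(\mathbb Z;<,+,R)$, where $R$ is regarded as the set $\{r_n \mid n\in\mathbb N\}$, as follows: $\lambda(x)=\max\{r\in R \mid r\le x\}$ if $x\ge r_0$ and $\lambda(x)=r_0$ otherwise, $S(x)=S(\lambda(x))$, and $S^{-1}(x)=S^{-1}(\lambda(x))$. Let $\kappa>\aleph_0$ and let $\mathcal U$ be a $\kappa$-saturated model, with underlying set $U$, of the complete theory of $(\mathbb Z;<,+,R)$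 (for example a monster model, with $\kappa$ its degree of saturation). Interpret $R$ and the definable symbols $0,1,-,\lambda,S,S^{-1}$ in $\mathcal U$, and let $L_R=\{0,1,<,+,-,R,\lambda,S,S^{-1}\}$. For $n\ge 2$ and $0\le i<n$, let $\cdot\equiv_n i$ be the unary relation on $R^{\mathcal U}$ consisting of those $x$ with $x\equiv i \pmod n$. Let $\mathcal I$ be the set of partial functions $f$ from $U$ to $U$ with $|\mathrm{Dom}(f)|<\kappa$ such that 1. $\mathrm{Dom}(f)$ is an $L_R$-substructure of $\mathcal U$; 2. $f$ is a partial $L_R$-embedding; 3. $f$ is a partial elementary embedding of $(U;<,+)$; 4. $f|_{\mathrm{Dom}(f)\cap R^{\mathcal U}}$ is a partial elementary embedding of $(R^{\mathcal U};<,(\cdot\equiv_n i)_{n,i})$. Then $\mathcal I$ is a back-and-forth system from $\mathcal U$ to itself in the language $\{<,+,R\}$: it is a nonempty set of partial $\{<,+,R\}$-embeddings such that for every $f\in\mathcal I$ and every $a\in U$ there is $g\in\mathcal I$ extending $f$ with $a\in\mathrm{Dom}(g)$, and for every $f\in\mathcal I$ and every $b\in U$ there is $g\in\mathcal I$ extending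 $f$ with $b\in\mathrm{Im}(g)$. Consequently, every $f\in\mathcal I$ is a partial $\{<,+,R\}$-elementary embedding. -/

import Mathlib

open FirstOrder

universe u

namespace AlmostSparse

/-! ### Almost sparse sequences -/

/-- The value at `r n` of the operator `A(x) = ∑ i, A i * S ^ i (x)` on the sequence `r`. Here `i`
ranges over finitely many integers and `S ^ i (r n) = r (n + i)`, read as `r 0` when `n + i < 0`
(since `S⁻¹ (r 0) = r 0`). -/
def opEval (r : ℕ → ℤ) (A : ℤ →₀ ℤ) (n : ℕ) : ℤ :=
  A.sum fun i c => c * r ((n : ℤ) + i).toNat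

/-- A strictly increasing sequence of integers is almost sparse if any two operators are comparable
almost everywhere, and `A >ₐₑ B` implies `A (S ^ Δ x) >ₐₑ B (S ^ Δ x) + x` for some `Δ ≥ 0`. -/
structure IsAlmostSparse (r : ℕ → ℤ) : Prop where
  strictMono : StrictMono r
  trichotomy : ∀ A B : ℤ →₀ ℤ,
    (∀ᶠ n in Filter.cofinite, opEval r B n < opEval r A n) ∨
    (∀ᶠ n in Filter.cofinite, opEval r A n < opEval r B n) ∨
    (∀ᶠ n in Filter.cofinite, opEval r A n = opEval r B n)
  growth : ∀ A B : ℤ →₀ ℤ, (∀ᶠ n in Filter.cofinite, opEval r B n < opEval r A n) →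
    ∃ Δ : ℕ, ∀ᶠ n in Filter.cofinite, opEval r B (n + Δ) + r n < opEval r A (n + Δ)

/-! ### Generalities on first-order structures -/

/-- A partial function from `M` to `N`. -/
structure PartialMap (M N : Type*) where
  dom : Set M
  toFun : dom → N

namespace PartialMap

variable {M N : Type*}

/-- The image of a partial function. -/
def image (f : PartialMap M N) : Set N := Set.range f.toFun

/-- `g` expands `f`. -/
def Expands (g f : PartialMap M N) : Prop :=
  ∃ h : f.dom ⊆ g.dom, ∀ x : f.dom, g.toFun ⟨x, h x.2⟩ = f.toFun x

variable (L : Language) [L.Structure M] [L.Structure N]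

/-- `f` is a partial `L`-embedding: it is injective, and preserves and reflects the relations and
the graphs of the functions of `L` on its domain. -/
structure IsPartialEmbedding (f : PartialMap M N) : Prop where
  injective : Function.Injective f.toFun
  map_rel : ∀ (n : ℕ) (R : L.Relations n) (x : Fin n → f.dom),
    Language.Structure.RelMap R (fun i => f.toFun (x i)) ↔
      Language.Structure.RelMap R (fun i => (x i : M))
  map_fun : ∀ (n : ℕ) (F : L.Functions n) (x : Fin n → f.dom) (y : f.dom),
    Language.Structure.funMap F (fun i => f.toFun (x i)) = f.toFun y ↔
      Language.Structure.funMap F (fun i => (x i : M)) = (y : M)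

/-- `f` is a partial `L`-elementary embedding. -/
def IsPartialElementary (f : PartialMap M N) : Prop :=
  ∀ (n : ℕ) (φ : L.Formula (Fin n)) (x : Fin n → f.dom),
    φ.Realize (fun i => f.toFun (x i)) ↔ φ.Realize (fun i => (x i : M))

end PartialMap

/-- A back-and-forth system in the language `L` between `M` and `N`. -/
structure IsBackAndForthSystem (L : Language) {M N : Type*} [L.Structure M] [L.Structure N]
    (I : Set (PartialMap M N)) : Prop where
  nonempty : I.Nonempty
  isPartialEmbedding : ∀ f ∈ I, f.IsPartialEmbedding L
  forth : ∀ (a : M), ∀ f ∈ I, ∃ g ∈ I, g.Expands f ∧ a ∈ g.dom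
  back : ∀ (b : N), ∀ f ∈ I, ∃ g ∈ I, g.Expands f ∧ b ∈ g.image

/-- `M` is `κ`-saturated: every set of formulas in one variable, with parameters from a subset of
`M` of cardinality less than `κ`, that is finitely satisfiable in `M` is realized in `M`. -/
def IsSaturated (L : Language) (κ : Cardinal.{u}) (M : Type u) [L.Structure M] : Prop :=
  ∀ A : Set M, Cardinal.mk A < κ → ∀ p : Set ((L.withConstants A).Formula Unit),
    (∀ s : Finset ((L.withConstants A).Formula Unit), (s : Set _) ⊆ p →
      ∃ m : M, ∀ φ ∈ s, φ.Realize (fun _ => m)) →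
    ∃ m : M, ∀ φ ∈ p, φ.Realize (fun _ => m)

/-! ### The languages -/

inductive PresFunc : ℕ → Type
  | add : PresFunc 2

inductive PresRel : ℕ → Type
  | lt : PresRel 2

/-- The language `{<, +}`. -/
def presLang : Language := ⟨PresFunc, PresRel⟩

inductive ZRFunc : ℕ → Type
  | add : ZRFunc 2

inductive ZRRel : ℕ → Type
  | lt : ZRRel 2
  | mem : ZRRel 1

/-- The language `{<, +, R}`. -/
def zrLang : Language := ⟨ZRFunc, ZRRel⟩

inductive LRFunc : ℕ → Type
  | zero : LRFunc 0
  | one : LRFunc 0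
  | add : LRFunc 2
  | neg : LRFunc 1
  | lam : LRFunc 1
  | succ : LRFunc 1
  | pred : LRFunc 1

inductive LRRel : ℕ → Type
  | lt : LRRel 2
  | mem : LRRel 1

/-- The language `L_R = {0, 1, <, +, -, R, λ, S, S⁻¹}`. -/
def lrLang : Language := ⟨LRFunc, LRRel⟩

inductive ResRel : ℕ → Type
  | lt : ResRel 2
  | cong (n i : ℕ) (hn : 2 ≤ n) (hi : i < n) : ResRel 1

/-- The relational language `{<} ∪ {(· ≡ₙ i) | n ≥ 2, 0 ≤ i < n}`. -/
def resLang : Language := ⟨fun _ => Empty, ResRel⟩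

/-- The structure `(ℤ; <, +, R)`, with `R` the set of terms of the sequence `r`. -/
@[reducible] def intStructure (r : ℕ → ℤ) : zrLang.Structure ℤ where
  funMap := fun {_} F => match F with
    | ZRFunc.add => fun v => v 0 + v 1
  RelMap := fun {_} P => match P with
    | ZRRel.lt => fun v => v 0 < v 1
    | ZRRel.mem => fun v => v 0 ∈ Set.range r

/-- The complete theory of `(ℤ; <, +, R)`. -/
def zrTheory (r : ℕ → ℤ) : zrLang.Theory :=
  letI := intStructure r
  zrLang.completeTheory ℤ

/-! ### Definable constants and functions in a `{<, +, R}`-structure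

In `(ℤ; <, +, R)`, and hence in every model of its theory, each of the elements selected below
exists and is unique. -/

section Model

variable {U : Type u} [zrLang.Structure U]

def add (x y : U) : U := Language.Structure.funMap (L := zrLang) ZRFunc.add ![x, y]

def Lt (x y : U) : Prop := Language.Structure.RelMap (L := zrLang) ZRRel.lt ![x, y]

def Le (x y : U) : Prop := Lt x y ∨ x = y

/-- Membership in the interpretation of `R`. -/
def MemR (x : U) : Prop := Language.Structure.RelMap (L := zrLang) ZRRel.mem ![x]

variable (U) in
/-- The interpretation of `R`, as a type. -/
def RSet : Type u := {x : U // MemR x}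

variable [Nonempty U]

/-- The least element satisfying `P`. -/
noncomputable def least (P : U → Prop) : U :=
  Classical.epsilon fun x => P x ∧ ∀ y, P y → Le x y

/-- The greatest element satisfying `P`. -/
noncomputable def greatest (P : U → Prop) : U :=
  Classical.epsilon fun x => P x ∧ ∀ y, P y → Le y x

variable (U) in
noncomputable def zero : U := Classical.epsilon fun x => ∀ y, add x y = y

variable (U) in
/-- The least positive element. -/
noncomputable def one : U := least fun x => Lt (zero U) x

noncomputable def neg (x : U) : U := Classical.epsilon fun y => add x y = zero U

variable (U) in
/-- The least element `r₀` of `R`. -/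
noncomputable def rMin : U := least fun x => MemR x

open Classical in
/-- `λ(x) = max {s ∈ R | s ≤ x}` if `r₀ ≤ x`, and `λ(x) = r₀` otherwise. -/
noncomputable def lam (x : U) : U :=
  if Le (rMin U) x then greatest fun s => MemR s ∧ Le s x else rMin U

/-- `S(x)`, the successor of `λ(x)` in `R`. -/
noncomputable def succ (x : U) : U := least fun s => MemR s ∧ Lt (lam x) s

open Classical in
/-- `S⁻¹(x)`, the predecessor of `λ(x)` in `R`, or `r₀` if `λ(x) = r₀`. -/
noncomputable def pred (x : U) : U :=
  if lam x = rMin U then rMin U else greatest fun s => MemR s ∧ Lt s (lam x)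

/-- `n • x = x + ⋯ + x`. -/
noncomputable def nmul : ℕ → U → U
  | 0, _ => zero U
  | n + 1, x => add (nmul n x) x

/-- `x ≡ i (mod n)`. -/
def Cong (n i : ℕ) (x : U) : Prop := ∃ y : U, x = add (nmul n y) (nmul i (one U))

/-- The structure `(U; 0, 1, <, +, -, R, λ, S, S⁻¹)`. -/
noncomputable instance lrStructure : lrLang.Structure U where
  funMap := fun {_} F => match F with
    | LRFunc.zero => fun _ => zero U
    | LRFunc.one => fun _ => one U
    | LRFunc.add => fun v => add (v 0) (v 1)
    | LRFunc.neg => fun v => neg (v 0)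
    | LRFunc.lam => fun v => lam (v 0)
    | LRFunc.succ => fun v => succ (v 0)
    | LRFunc.pred => fun v => pred (v 0)
  RelMap := fun {_} P => match P with
    | LRRel.lt => fun v => Lt (v 0) (v 1)
    | LRRel.mem => fun v => MemR (v 0)

/-- The structure `(R; <, (· ≡ₙ i))` on the interpretation of `R` in `U`. -/
instance resStructure : resLang.Structure (RSet U) where
  funMap := fun {_} F => nomatch F
  RelMap := fun {_} P => match P with
    | ResRel.lt => fun v => Lt (v 0).1 (v 1).1
    | ResRel.cong n i _ _ => fun v => Cong n i (v 0).1

end Model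

/-- The reduct `(U; <, +)`. -/
instance presStructure {U : Type u} [zrLang.Structure U] : presLang.Structure U where
  funMap := fun {_} F => match F with
    | PresFunc.add => fun v => add (v 0) (v 1)
  RelMap := fun {_} P => match P with
    | PresRel.lt => fun v => Lt (v 0) (v 1)

/-! ### The back-and-forth system -/

/-- The partial functions `f` from `U` to `U` with small domain (of cardinality less than `κ`)
such that the domain is an `L_R`-substructure, `f` is a partial `L_R`-embedding and a partial
elementary embedding of `(U; <, +)`, and `f` restricts to a partial elementary embedding of
`(R; <, (· ≡ₙ i))`. -/
structure InSystem {U : Type u} [zrLang.Structure U] [Nonempty U] (κ : Cardinal.{u})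
    (f : PartialMap U U) : Prop where
  small : Cardinal.mk f.dom < κ
  dom_substructure : ∃ N : lrLang.Substructure U, (N : Set U) = f.dom
  isPartialEmbedding : f.IsPartialEmbedding lrLang
  isPartialElementary : f.IsPartialElementary presLang
  restrict : ∃ g : PartialMap (RSet U) (RSet U),
    (∀ x : RSet U, x ∈ g.dom ↔ x.1 ∈ f.dom) ∧
    (∀ (x : g.dom) (hx : x.1.1 ∈ f.dom), (g.toFun x).1 = f.toFun ⟨x.1.1, hx⟩) ∧
    g.IsPartialElementary resLang

/-- The set `𝓘` of all these partial functions. -/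
def system (U : Type u) [zrLang.Structure U] [Nonempty U] (κ : Cardinal.{u}) :
    Set (PartialMap U U) := {f | InSystem κ f}

end AlmostSparse

set_option linter.unusedSectionVars false
set_option linter.flexible false

/-! A member of the system is handled through its graph, a subgroup `G` of `U × U`
(`IsSystemGraph`): it preserves sign, its two coordinates agree modulo every nonzero `n`, it is
closed under `λ`, `S`, `S⁻¹`, it is small, and its trace on `R` is elementary for order and
residues. `InSystem.exists_graph` and `IsSystemGraph.inSystem` pass between the two views.
Elementarity for `(U; <, +)` amounts to sign and congruences because of `PresSys.elem`, a semantic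
form of Presburger quantifier elimination. The graph conditions are symmetric, so "back" is "forth"
for the inverse graph.

To add `a` to the domain, let `N` be the substructure generated by the domain and `a`; it is still
small. Saturation extends the trace on `R` to an elementary map defined on all of `N ∩ R`
(`Elem.exists_total`). The elements of `N ∩ R` then enter the domain one `ℤ`-orbit of `S` at a time
(`Sys.exists_cover`). Finally `a` itself is added by a Presburger step: every value of `λ` on `N` is
already in the domain, so order and congruences are all that has to be matched (`Sys.exists_forth`).

Almost sparsity is what makes an orbit step work. It transfers to `U` as `orbit_trichotomy`: for a
fixed integer combination `z` there is one `k` such that, on every orbit `σ`, `z` vanishes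
identically, or exceeds `σ (-k)`, or is below `-σ (-k)`. An old domain element `d` is either smaller
in absolute value than the whole new orbit or larger than all of it. In the first case the sign of
`d + z(σ)` is that of `z`, or that of `d` if `z` vanishes; in the second it is that of `d`. Either
way it is the same for the image orbit (`OrbitPair.presSys`). The same estimates locate `λ (d +
z(σ))` in the old domain or on the new orbit (`OrbitPair.lam_cases`), so nothing else joins `R`. -/

namespace AlmostSparse

open Language

/-! ### Formulas of `{<, +, R}` and their meaning -/

section Formulas

variable {α γ : Type*} {n : ℕ}

/-- The term `t + s`. -/
def addT (t s : zrLang.Term γ) : zrLang.Term γ := Functions.apply₂ (L := zrLang) ZRFunc.add t s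

/-- The formula `t < s`. -/
def ltF (t s : zrLang.Term (α ⊕ Fin n)) : zrLang.BoundedFormula α n :=
  Relations.boundedFormula₂ (L := zrLang) ZRRel.lt t s

/-- The formula `t ∈ R`. -/
def memF (t : zrLang.Term (α ⊕ Fin n)) : zrLang.BoundedFormula α n :=
  Relations.boundedFormula₁ (L := zrLang) ZRRel.mem t

/-- The formula saying that `s` is the successor of `t` in `R`. -/
def nextF (t s : Fin n) : zrLang.BoundedFormula α n :=
  memF (&t) ⊓ memF (&s) ⊓ ltF (&t) (&s) ⊓
    ∀' ((memF (&(Fin.last n))).imp ((ltF (&(Fin.castSucc t)) (&(Fin.last n))).imp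
      (ltF (&(Fin.last n)) (&(Fin.castSucc s))).not))

/-- The term `n • t + s`. -/
def nsmulAddT {L : Language} (F : L.Functions 2) (t s : L.Term γ) : ℕ → L.Term γ
  | 0 => s
  | n + 1 => F.apply₂ t (nsmulAddT F t s n)

/-- The pair of terms `(p, q)` with `p - q` equal to the given linear combination. -/
def linT (x : zrLang.Term γ) : List (ℤ × zrLang.Term γ) → zrLang.Term γ × zrLang.Term γ
  | [] => (x, x)
  | (c, t) :: l =>
    (nsmulAddT (L := zrLang) ZRFunc.add t (linT x l).1 c.toNat,
      nsmulAddT (L := zrLang) ZRFunc.add t (linT x l).2 (-c).toNat)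

/-- The formula saying that the given linear combination is positive. -/
def posF (x : zrLang.Term (α ⊕ Fin n)) (l : List (ℤ × zrLang.Term (α ⊕ Fin n))) :
    zrLang.BoundedFormula α n := ltF (linT x l).2 (linT x l).1

/-- `y` is the successor of `x` in `R`. -/
def Next {U : Type u} [zrLang.Structure U] (x y : U) : Prop :=
  MemR x ∧ MemR y ∧ Lt x y ∧ ∀ t, MemR t → Lt x t → ¬ Lt t y

variable {U : Type u} [zrLang.Structure U]

@[simp] lemma realize_addT (t s : zrLang.Term γ) (v : γ → U) :
    (addT t s).realize v = add (t.realize v) (s.realize v) := Term.realize_functions_apply₂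

@[simp] lemma realize_ltF (t s : zrLang.Term (α ⊕ Fin n)) (v : α → U) (xs : Fin n → U) :
    (ltF t s).Realize v xs ↔ Lt (t.realize (Sum.elim v xs)) (s.realize (Sum.elim v xs)) :=
  BoundedFormula.realize_rel₂

@[simp] lemma realize_memF (t : zrLang.Term (α ⊕ Fin n)) (v : α → U) (xs : Fin n → U) :
    (memF t).Realize v xs ↔ MemR (t.realize (Sum.elim v xs)) :=
  BoundedFormula.realize_rel₁

@[simp] lemma realize_nextF (t s : Fin n) (v : α → U) (xs : Fin n → U) :
    (nextF t s).Realize v xs ↔ Next (xs t) (xs s) := by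
  simp [nextF, Next, and_assoc]

lemma realize_nsmulAddT {L : Language} {M : Type*} [L.Structure M] [AddCommGroup M]
    {F : L.Functions 2} (hF : ∀ x y : M, Structure.funMap F ![x, y] = x + y)
    (t s : L.Term γ) (v : γ → M) (n : ℕ) :
    (nsmulAddT F t s n).realize v = n • t.realize v + s.realize v := by
  induction n with
  | zero => simp [nsmulAddT]
  | succ n ih => rw [nsmulAddT, Term.realize_functions_apply₂, hF, ih, succ_nsmul]; abel

end Formulas

/-! ### Linear inequalities in an ordered group model -/

section GroupModel

/-- The group and order structures on `U` are those given by `+` and `<`. -/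
class IsGroupModel (U : Type u) [zrLang.Structure U] [AddCommGroup U] [LinearOrder U] : Prop where
  add_eq : ∀ x y : U, AlmostSparse.add x y = x + y
  lt_iff : ∀ x y : U, Lt x y ↔ x < y

variable {α γ : Type*} {n : ℕ}
variable {U : Type u} [zrLang.Structure U] [AddCommGroup U] [LinearOrder U] [IsGroupModel U]

lemma realize_linT (x : zrLang.Term γ) (l : List (ℤ × zrLang.Term γ)) (v : γ → U) :
    (linT x l).1.realize v - (linT x l).2.realize v =
      (l.map fun p => p.1 • p.2.realize v).sum := by
  have hF : ∀ x y : U, Structure.funMap (L := zrLang) ZRFunc.add ![x, y] = x + y :=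
    IsGroupModel.add_eq
  induction l with
  | nil => simp [linT]
  | cons p l ih =>
    obtain ⟨c, t⟩ := p
    have hc : c = (c.toNat : ℤ) - ((-c).toNat : ℤ) := by omega
    rw [List.map_cons, List.sum_cons, ← ih]
    simp only [linT, realize_nsmulAddT hF]
    conv_rhs => rw [hc, sub_smul, natCast_zsmul, natCast_zsmul]
    abel

@[simp] lemma realize_posF [IsOrderedAddMonoid U] (x : zrLang.Term (α ⊕ Fin n)) (l : List (ℤ × zrLang.Term (α ⊕ Fin n)))
    (v : α → U) (xs : Fin n → U) :
    (posF x l).Realize v xs ↔ 0 < (l.map fun p => p.1 • p.2.realize (Sum.elim v xs)).sum := by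
  rw [posF, realize_ltF, IsGroupModel.lt_iff, ← realize_linT x l, sub_pos]

end GroupModel

/-! ### Ordered group axioms transferred from `ℤ` -/

section Transfer

variable {r : ℕ → ℤ} {U : Type u} [zrLang.Structure U]

lemma isGroupModel_int (r : ℕ → ℤ) : @IsGroupModel ℤ (intStructure r) _ _ :=
  let _ := intStructure r
  ⟨fun _ _ => rfl, fun _ _ => Iff.rfl⟩

lemma transfer (hU : U ⊨ zrTheory r) (φ : zrLang.Sentence)
    (h : @Sentence.Realize zrLang ℤ (intStructure r) φ) : U ⊨ φ := by
  let _ := intStructure r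
  exact hU.realize_of_mem φ ((mem_completeTheory).2 h)


lemma add_assoc_raw (hU : U ⊨ zrTheory r) (x y z : U) : add (add x y) z = add x (add y z) := by
  have h := transfer hU (∀' ∀' ∀' ((addT (addT (&0) (&1)) (&2)) =' (addT (&0) (addT (&1) (&2)))))
    (by
      let _ := intStructure r
      have := isGroupModel_int r
      simp [Sentence.Realize, Formula.Realize, Fin.snoc, IsGroupModel.add_eq, add_assoc])
  simp [Sentence.Realize, Formula.Realize, Fin.snoc] at h
  exact h x y z

lemma add_comm_raw (hU : U ⊨ zrTheory r) (x y : U) : add x y = add y x := by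
  have h := transfer hU (∀' ∀' ((addT (&0) (&1)) =' (addT (&1) (&0))))
    (by
      let _ := intStructure r
      have := isGroupModel_int r
      simp [Sentence.Realize, Formula.Realize, Fin.snoc, IsGroupModel.add_eq, add_comm])
  simp [Sentence.Realize, Formula.Realize, Fin.snoc] at h
  exact h x y

lemma exists_zero_raw (hU : U ⊨ zrTheory r) :
    ∃ z : U, ∀ x, add z x = x ∧ ∃ y, add x y = z := by
  have h := transfer hU (∃' ∀' (((addT (&0) (&1)) =' (&1)) ⊓ (∃' ((addT (&1) (&2)) =' (&0)))))
    (by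
      let _ := intStructure r
      have := isGroupModel_int r
      simp [Sentence.Realize, Formula.Realize, Fin.snoc, IsGroupModel.add_eq]
      exact ⟨0, fun x => ⟨by simp, -x, by simp⟩⟩)
  simpa [Sentence.Realize, Formula.Realize, Fin.snoc] using h

lemma lt_trans_raw (hU : U ⊨ zrTheory r) (x y z : U) (hxy : Lt x y) (hyz : Lt y z) : Lt x z := by
  have h := transfer hU
    (∀' ∀' ∀' ((ltF (&0) (&1)).imp ((ltF (&1) (&2)).imp (ltF (&0) (&2)))))
    (by
      let _ := intStructure r
      have := isGroupModel_int r
      simp [Sentence.Realize, Formula.Realize, Fin.snoc, IsGroupModel.lt_iff]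
      intro a b c; exact lt_trans)
  simp [Sentence.Realize, Formula.Realize, Fin.snoc] at h
  exact h x y z hxy hyz

lemma lt_trichotomy_raw (hU : U ⊨ zrTheory r) (x y : U) :
    ¬ Lt x x ∧ (Lt x y ∨ x = y ∨ Lt y x) := by
  have h := transfer hU
    (∀' ∀' ((ltF (&0) (&0)).not ⊓ ((ltF (&0) (&1)) ⊔ (((&0) =' (&1)) ⊔ (ltF (&1) (&0))))))
    (by
      let _ := intStructure r
      have := isGroupModel_int r
      simp [Sentence.Realize, Formula.Realize, Fin.snoc, IsGroupModel.lt_iff]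
      exact lt_trichotomy)
  simp [Sentence.Realize, Formula.Realize, Fin.snoc] at h
  exact h x y

lemma add_lt_add_raw (hU : U ⊨ zrTheory r) (x y z : U) (hxy : Lt x y) :
    Lt (add z x) (add z y) := by
  have h := transfer hU
    (∀' ∀' ∀' ((ltF (&0) (&1)).imp (ltF (addT (&2) (&0)) (addT (&2) (&1)))))
    (by
      let _ := intStructure r
      have := isGroupModel_int r
      simp [Sentence.Realize, Formula.Realize, Fin.snoc, IsGroupModel.lt_iff,
        IsGroupModel.add_eq])
  simp [Sentence.Realize, Formula.Realize, Fin.snoc] at h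
  exact h x y z hxy

/-- The additive group of a model. -/
noncomputable abbrev addCommGroupOfModel (hU : U ⊨ zrTheory r) : AddCommGroup U where
  add := AlmostSparse.add
  add_assoc := add_assoc_raw hU
  add_comm := add_comm_raw hU
  zero := (exists_zero_raw hU).choose
  zero_add x := ((exists_zero_raw hU).choose_spec x).1
  add_zero x := (add_comm_raw hU _ _).trans ((exists_zero_raw hU).choose_spec x).1
  neg x := ((exists_zero_raw hU).choose_spec x).2.choose
  neg_add_cancel x :=
    (add_comm_raw hU _ _).trans ((exists_zero_raw hU).choose_spec x).2.choose_spec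
  nsmul := @nsmulRec U ⟨(exists_zero_raw hU).choose⟩ ⟨AlmostSparse.add⟩
  zsmul := @zsmulRec U ⟨(exists_zero_raw hU).choose⟩ ⟨AlmostSparse.add⟩
    ⟨fun x => ((exists_zero_raw hU).choose_spec x).2.choose⟩
    (@nsmulRec U ⟨(exists_zero_raw hU).choose⟩ ⟨AlmostSparse.add⟩)

/-- The linear order of a model. -/
noncomputable abbrev linearOrderOfModel (hU : U ⊨ zrTheory r) : LinearOrder U :=
  { lt := Lt
    le := Le
    le_refl := fun _ => Or.inr rfl
    le_trans := by
      rintro a b c (h | rfl) (h' | rfl)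
      · exact Or.inl (lt_trans_raw hU _ _ _ h h')
      · exact Or.inl h
      · exact Or.inl h'
      · exact Or.inr rfl
    lt_iff_le_not_ge := by
      intro a b
      have h1 := (lt_trichotomy_raw hU a b).1
      refine ⟨fun h => ⟨Or.inl h, ?_⟩, ?_⟩
      · rintro (h' | rfl)
        · exact h1 (lt_trans_raw hU _ _ _ h h')
        · exact h1 h
      · rintro ⟨h | rfl, h'⟩
        · exact h
        · exact absurd (Or.inr rfl) h'
    le_antisymm := by
      rintro a b (h | rfl) (h' | h')
      · exact absurd (lt_trans_raw hU _ _ _ h h') (lt_trichotomy_raw hU a b).1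
      · exact h'.symm
      · rfl
      · rfl
    le_total := by
      intro a b
      rcases (lt_trichotomy_raw hU a b).2 with h | h | h
      · exact Or.inl (Or.inl h)
      · exact Or.inl (Or.inr h)
      · exact Or.inr (Or.inl h)
    toDecidableLE := Classical.decRel _ }

lemma isOrderedAddMonoid_of_model (hU : U ⊨ zrTheory r) :
    @IsOrderedAddMonoid U (addCommGroupOfModel hU).toAddCommMonoid
      (linearOrderOfModel hU).toPartialOrder.toPreorder :=
  let _ := addCommGroupOfModel hU
  let _ := linearOrderOfModel hU
  { add_le_add_left := by
      rintro a b (h | rfl) c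
      · exact Or.inl (by
          have := add_lt_add_raw hU a b c h
          rwa [add_comm_raw hU c, add_comm_raw hU c] at this)
      · exact Or.inr rfl }

lemma isGroupModel_of_model (hU : U ⊨ zrTheory r) :
    @IsGroupModel U _ (addCommGroupOfModel hU) (linearOrderOfModel hU) :=
  let _ := addCommGroupOfModel hU
  let _ := linearOrderOfModel hU
  ⟨fun _ _ => rfl, fun _ _ => Iff.rfl⟩

end Transfer

/-! ### Discreteness, division and the order type of `R`, transferred from `ℤ` -/

section Model

variable {r : ℕ → ℤ} {U : Type u} [zrLang.Structure U] [AddCommGroup U] [LinearOrder U]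
  [IsOrderedAddMonoid U] [IsGroupModel U]

lemma discrete (hU : U ⊨ zrTheory r) : ∃ e : U, 0 < e ∧ ∀ x, 0 < x → e ≤ x := by
  have h := transfer hU
    (∃' (posF (&0) [(1, &0)] ⊓ ∀' ((posF (&0) [(1, &1)]).imp (ltF (&1) (&0)).not)))
    (by
      let _ := intStructure r
      have := isGroupModel_int r
      simp [Sentence.Realize, Formula.Realize, Fin.snoc, IsGroupModel.lt_iff]
      exact ⟨1, by omega, by omega⟩)
  simpa [Sentence.Realize, Formula.Realize, Fin.snoc, IsGroupModel.lt_iff] using h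

/-- The language has no symbol for `1`, so the transferred sentence quantifies over a least positive
element `e`. -/
lemma division_aux (hU : U ⊨ zrTheory r) (n : ℕ) (hn : n ≠ 0) (e : U)
    (he : 0 < e ∧ ∀ x, 0 < x → e ≤ x) (x : U) : ∃ y, 0 ≤ x - n • y ∧ x - n • y < n • e := by
  have h := transfer hU
    (∀' ((posF (&0) [(1, &0)] ⊓ ∀' ((posF (&0) [(1, &1)]).imp (ltF (&1) (&0)).not)).imp
      (∀' ∃' ((posF (&0) [(n, &2), (-1, &1)]).not ⊓
        posF (&0) [(n, &0), (n, &2), (-1, &1)]))))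
    (by
      let _ := intStructure r
      have := isGroupModel_int r
      simp [Sentence.Realize, Formula.Realize, Fin.snoc, IsGroupModel.lt_iff]
      intro e he h x
      have : e = 1 := le_antisymm (h 1 (by omega)) (by omega)
      subst this
      refine ⟨x / n, ?_⟩
      have h1 := Int.emod_nonneg x (show (n : ℤ) ≠ 0 by omega)
      have h2 := Int.emod_lt_of_pos x (show 0 < (n : ℤ) by omega)
      have h3 := Int.emod_add_mul_ediv x n
      constructor <;> linarith)
  simp [Sentence.Realize, Formula.Realize, Fin.snoc, IsGroupModel.lt_iff] at h
  obtain ⟨y, h1, h2⟩ := h e he.1 he.2 x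
  refine ⟨y, by simpa using h1, ?_⟩
  rw [← sub_pos]
  convert h2 using 1
  abel

lemma exists_rMin (hU : U ⊨ zrTheory r) (hr : StrictMono r) :
    ∃ x : U, MemR x ∧ ∀ y, MemR y → x ≤ y := by
  have h := transfer hU
    (∃' (memF (&0) ⊓ ∀' ((memF (&1)).imp (ltF (&1) (&0)).not)))
    (by
      let _ := intStructure r
      have := isGroupModel_int r
      simp [Sentence.Realize, Formula.Realize, Fin.snoc, IsGroupModel.lt_iff]
      refine ⟨r 0, ⟨0, rfl⟩, ?_⟩
      rintro _ ⟨n, rfl⟩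
      exact hr.monotone (Nat.zero_le n))
  simpa [Sentence.Realize, Formula.Realize, Fin.snoc, IsGroupModel.lt_iff] using h

/-- A standard lower bound for `R`; it later forces the elements of a `ℤ`-orbit to exceed every
standard integer. -/
lemma zsmul_le_of_memR_aux (hU : U ⊨ zrTheory r) (hr : StrictMono r) (e : U)
    (he : 0 < e ∧ ∀ x, 0 < x → e ≤ x) (x : U) (hx : MemR x) : r 0 • e ≤ x := by
  have h := transfer hU
    (∀' ((posF (&0) [(1, &0)] ⊓ ∀' ((posF (&0) [(1, &1)]).imp (ltF (&1) (&0)).not)).imp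
      (∀' ((memF (&1)).imp (posF (&0) [(r 0, &0), (-1, &1)]).not))))
    (by
      let _ := intStructure r
      have := isGroupModel_int r
      simp [Sentence.Realize, Formula.Realize, Fin.snoc, IsGroupModel.lt_iff]
      intro e he h
      have : e = 1 := le_antisymm (h 1 (by omega)) (by omega)
      subst this
      rintro _ ⟨n, rfl⟩
      have := hr.monotone (Nat.zero_le n)
      simpa using this)
  simp [Sentence.Realize, Formula.Realize, Fin.snoc, IsGroupModel.lt_iff] at h
  simpa using h e he.1 he.2 x hx

lemma exists_greatest_memR_le (hU : U ⊨ zrTheory r) (hr : StrictMono r) (x s : U) (hs : MemR s)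
    (hsx : s ≤ x) : ∃ m, MemR m ∧ m ≤ x ∧ ∀ t, MemR t → t ≤ x → t ≤ m := by
  have h := transfer hU
    (∀' ∀' ((memF (&1)).imp ((ltF (&0) (&1)).not.imp
      (∃' (memF (&2) ⊓ ((ltF (&0) (&2)).not ⊓
        ∀' ((memF (&3)).imp ((ltF (&0) (&3)).not.imp (ltF (&2) (&3)).not))))))))
    (by
      let _ := intStructure r
      have := isGroupModel_int r
      simp [Sentence.Realize, Formula.Realize, Fin.snoc, IsGroupModel.lt_iff]
      rintro x _ ⟨n, rfl⟩ hn
      -- A strictly increasing integer sequence satisfies `k ≤ r k - r 0`, so only finitely many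
      -- terms lie below `x`.
      have hb : ∃ b, ∀ k, r k ≤ x → k ≤ b := by
        refine ⟨(x - r 0).toNat, fun k hk => ?_⟩
        have : (k : ℤ) ≤ r k - r 0 := by
          clear hk
          induction k with
          | zero => simp
          | succ k ih =>
            have := hr (Nat.lt_succ_self k)
            push_cast
            simp only [Nat.succ_eq_add_one] at this
            omega
        omega
      classical
      obtain ⟨b, hb⟩ := hb
      refine ⟨r (Nat.findGreatest (fun k => r k ≤ x) b), ⟨_, rfl⟩,
        Nat.findGreatest_spec (P := fun k => r k ≤ x) (hb n hn) hn, ?_⟩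
      rintro _ ⟨k, rfl⟩ hk
      exact hr.monotone (Nat.le_findGreatest (hb k hk) hk))
  simp [Sentence.Realize, Formula.Realize, Fin.snoc, IsGroupModel.lt_iff] at h
  exact h x s hs hsx

lemma exists_next (hU : U ⊨ zrTheory r) (hr : StrictMono r) (x : U) (hx : MemR x) :
    ∃ y, Next x y := by
  have h := transfer hU (∀' ((memF (&0)).imp (∃' (nextF 0 1))))
    (by
      let _ := intStructure r
      have := isGroupModel_int r
      simp [Sentence.Realize, Formula.Realize, Fin.snoc]
      rintro _ ⟨n, rfl⟩
      refine ⟨r (n + 1), ⟨n, rfl⟩, ⟨n + 1, rfl⟩, hr (Nat.lt_succ_self n), ?_⟩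
      rintro _ ⟨k, rfl⟩ h1 h2
      have h1 : n < k := hr.lt_iff_lt.1 h1
      have h2 : k < n + 1 := hr.lt_iff_lt.1 h2
      omega)
  simp [Sentence.Realize, Formula.Realize, Fin.snoc] at h
  exact h x hx

lemma exists_prev (hU : U ⊨ zrTheory r) (hr : StrictMono r) (x y : U) (hx : MemR x)
    (hy : MemR y) (hyx : y < x) : ∃ z, Next z x := by
  have h := transfer hU
    (∀' ∀' ((memF (&0)).imp ((memF (&1)).imp ((ltF (&1) (&0)).imp (∃' (nextF 2 0))))))
    (by
      let _ := intStructure r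
      have := isGroupModel_int r
      simp [Sentence.Realize, Formula.Realize, Fin.snoc]
      rintro _ _ ⟨n, rfl⟩ ⟨m, rfl⟩ hmn
      have hmn : m < n := hr.lt_iff_lt.1 hmn
      refine ⟨r (n - 1), ⟨n - 1, rfl⟩, ⟨n, rfl⟩, hr (by omega), ?_⟩
      rintro _ ⟨k, rfl⟩ h1 h2
      have h1 : n - 1 < k := hr.lt_iff_lt.1 h1
      have h2 : k < n := hr.lt_iff_lt.1 h2
      omega)
  simp [Sentence.Realize, Formula.Realize, Fin.snoc, IsGroupModel.lt_iff] at h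
  exact h x y hx hy hyx

end Model

/-- A `ℤ`-indexed sequence of consecutive elements of `R`. -/
def IsOrbit {U : Type u} [zrLang.Structure U] (σ : ℤ → U) : Prop := ∀ i, Next (σ i) (σ (i + 1))

/-! ### Almost sparsity transferred to `ℤ`-orbits -/

section Window

variable {r : ℕ → ℤ} {U : Type u} [zrLang.Structure U]

lemma next_int_iff (hr : StrictMono r) (n : ℕ) (y : ℤ) :
    (@Next ℤ (intStructure r) (r n) y) ↔ y = r (n + 1) := by
  let _ := intStructure r
  constructor
  · rintro ⟨-, ⟨k, rfl⟩, h2, h3⟩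
    have h2 : n < k := hr.lt_iff_lt.1 h2
    by_contra hne
    refine h3 (r (n + 1)) ⟨n + 1, rfl⟩ (hr (Nat.lt_succ_self n)) ?_
    have hk : k ≠ n + 1 := fun h => hne (by rw [h])
    exact hr (show n + 1 < k by omega)
  · rintro rfl
    refine ⟨⟨n, rfl⟩, ⟨n + 1, rfl⟩, hr (Nat.lt_succ_self n), ?_⟩
    rintro _ ⟨k, rfl⟩ h1 h2
    have h1 : n < k := hr.lt_iff_lt.1 h1
    have h2 : k < n + 1 := hr.lt_iff_lt.1 h2
    omega

/-- In `ℤ` the tuples of consecutive elements of `R` are exactly the windows `r n, r (n + 1), …`, so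
a property of all windows is a single first-order sentence. -/
lemma transfer_window (hU : U ⊨ zrTheory r) (hr : StrictMono r) {W : ℕ}
    (θ : zrLang.BoundedFormula Empty (W + 2))
    (h : ∀ n : ℕ, @BoundedFormula.Realize zrLang ℤ (intStructure r) _ _ θ default
      (fun j => r (n + j)))
    (w : ℕ → U) (hw : ∀ j, Next (w j) (w (j + 1))) : θ.Realize default (fun j => w j) := by
  have h := transfer hU
    ((BoundedFormula.iInf fun j : Fin (W + 1) => nextF j.castSucc j.succ).imp θ).alls
    (by
      let _ := intStructure r
      simp only [Sentence.Realize, BoundedFormula.realize_alls, BoundedFormula.realize_imp,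
        BoundedFormula.realize_iInf, realize_nextF]
      intro xs hxs
      obtain ⟨n, hn⟩ : xs 0 ∈ Set.range r := (hxs 0).1
      have key : ∀ j (hj : j < W + 2), xs ⟨j, hj⟩ = r (n + j) := by
        intro j
        induction j with
        | zero => intro _; exact hn.symm
        | succ j ih =>
          intro hj
          have h1 := hxs ⟨j, by omega⟩
          have h2 := ih (by omega)
          simp only [Fin.castSucc_mk, Fin.succ_mk, h2] at h1
          exact (next_int_iff hr _ _).1 h1
      have hxs' : xs = fun j : Fin (W + 2) => r (n + (j : ℕ)) := funext fun j => key j j.2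
      rw [hxs']
      convert h n)
  simp only [Sentence.Realize, BoundedFormula.realize_alls, BoundedFormula.realize_imp,
    BoundedFormula.realize_iInf, realize_nextF] at h
  exact h _ fun j => hw j

variable [AddCommGroup U] [LinearOrder U] [IsOrderedAddMonoid U] [IsGroupModel U]

lemma opEval_eq (z : ℤ →₀ ℤ) (n : ℕ) :
    opEval r z n = Finsupp.linearCombination ℤ (fun i : ℤ => r ((n : ℤ) + i).toNat) z := by
  simp [opEval, Finsupp.linearCombination_apply]

lemma sum_toList_support {V : Type*} [AddCommGroup V] (z : ℤ →₀ ℤ) (f : ℤ → V) :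
    (z.support.toList.map fun i => z i • f i).sum = Finsupp.linearCombination ℤ f z := by
  rw [Finsupp.linearCombination_apply, Finsupp.sum, Finset.sum_map_toList]

/-- An orbit has no first element, so the finite exceptional set disappears: the window can start
far enough to the left of the support of `z`. -/
lemma orbit_pos_iff (hU : U ⊨ zrTheory r) (hr : StrictMono r) (z : ℤ →₀ ℤ) (m : ℕ) (p : Prop)
    (h : ∀ n, m ≤ n → (0 < opEval r z n ↔ p)) (σ : ℤ → U) (hσ : IsOrbit σ) :
    0 < Finsupp.linearCombination ℤ σ z ↔ p := by
  classical
  obtain ⟨N, hN⟩ : ∃ N : ℕ, ∀ i ∈ z.support, i.natAbs ≤ N :=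
    ⟨z.support.sup Int.natAbs, fun i hi => Finset.le_sup (f := Int.natAbs) hi⟩
  -- With the centre of the window at position `off`, the operator is evaluated at `n + off ≥ m`,
  -- and no index reaches the truncation at `r 0`.
  let off : ℕ := m + N
  let W : ℕ := off + N
  -- The truncations only make `idx` total; `hidx` shows that they are inactive on the support.
  let idx : ℤ → Fin (W + 2) := fun i => ⟨min (off + i).toNat W, by omega⟩
  have hidx : ∀ i ∈ z.support, ((idx i : ℕ) : ℤ) = off + i := by
    intro i hi
    have := hN i hi
    simp only [idx, off, W]
    omega
  let l : List (ℤ × zrLang.Term (Empty ⊕ Fin (W + 2))) := z.support.toList.map fun i => (z i, &(idx i))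
  have hZ : ∀ n : ℕ, (@BoundedFormula.Realize zrLang ℤ (intStructure r) _ _ (posF (&0) l) default
      (fun j => r (n + j))) ↔ p := by
    intro n
    let _ := intStructure r
    have := isGroupModel_int r
    rw [realize_posF, List.map_map, ← h (n + off) (by omega), opEval_eq, ← sum_toList_support]
    have : (z.support.toList.map ((fun q : ℤ × zrLang.Term (Empty ⊕ Fin (W + 2)) =>
        q.1 • q.2.realize (Sum.elim default fun j : Fin (W + 2) => r (n + j))) ∘
          fun i => (z i, &(idx i)))) =
        z.support.toList.map fun i => z i • r (((n + off : ℕ) : ℤ) + i).toNat := by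
      refine List.map_congr_left fun i hi => ?_
      have h1 := hidx i (by simpa using hi)
      have h2 : (((n + off : ℕ) : ℤ) + i).toNat = n + idx i := by omega
      simp only [Function.comp_apply, Term.realize_var, Sum.elim_inr, h2]
    rw [this]
  have key : (posF (&0) l).Realize default (fun j : Fin (W + 2) => σ ((j : ℕ) - off)) ↔ p := by
    by_cases hp : p
    · simp only [hp, iff_true] at hZ ⊢
      refine transfer_window hU hr _ hZ (fun j : ℕ => σ (j - off)) fun j => ?_
      have := hσ (j - off)
      push_cast
      rwa [show (j : ℤ) + 1 - off = j - off + 1 by ring]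
    · simp only [hp, iff_false] at hZ ⊢
      have := transfer_window hU hr (posF (&0) l).not (fun n => by
        let _ := intStructure r
        exact BoundedFormula.realize_not.2 (hZ n)) (fun j : ℕ => σ (j - off)) fun j => by
          have := hσ (j - off)
          push_cast
          rwa [show (j : ℤ) + 1 - off = j - off + 1 by ring]
      exact BoundedFormula.realize_not.1 this
  rw [← key, realize_posF, List.map_map, ← sum_toList_support]
  have : (z.support.toList.map ((fun q : ℤ × zrLang.Term (Empty ⊕ Fin (W + 2)) =>
      q.1 • q.2.realize (Sum.elim default fun j : Fin (W + 2) => σ ((j : ℕ) - off))) ∘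
        fun i => (z i, &(idx i)))) = z.support.toList.map fun i => z i • σ i := by
    refine List.map_congr_left fun i hi => ?_
    have h1 := hidx i (by simpa using hi)
    simp [h1]
  rw [this]

/-- Growth against the zero operator says that `z - S⁻ᵏ` is eventually positive, which is a sign
condition to which `orbit_pos_iff` applies. -/
lemma orbit_growth (hU : U ⊨ zrTheory r) (hr : IsAlmostSparse r) (z : ℤ →₀ ℤ)
    (hz : ∀ᶠ n in Filter.cofinite, 0 < opEval r z n) :
    ∃ k : ℕ, ∀ σ : ℤ → U, IsOrbit σ → σ (-k) < Finsupp.linearCombination ℤ σ z := by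
  obtain ⟨k, hk⟩ := hr.growth z 0 (by simpa [opEval] using hz)
  rw [Nat.cofinite_eq_atTop, Filter.eventually_atTop] at hk
  obtain ⟨m, hm⟩ := hk
  refine ⟨k, fun σ hσ => ?_⟩
  -- From `m + k` on, `n - k` is a genuine index, at least `m`.
  have := (orbit_pos_iff hU hr.strictMono (z - Finsupp.single (-(k : ℤ)) 1) (m + k) True ?_ σ hσ).2
    trivial
  · simpa using this
  · intro n hn
    have h1 := hm (n - k) (by omega)
    rw [Nat.sub_add_cancel (by omega)] at h1
    have h2 : ((n : ℤ) + -k).toNat = n - k := by omega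
    rw [opEval_eq, map_sub, Finsupp.linearCombination_single, ← opEval_eq, h2]
    simp [opEval] at h1 ⊢
    exact h1

/-- Both the alternative and `k` depend on `z` alone, so an orbit and its image always fall under
the same alternative. -/
lemma orbit_trichotomy (hU : U ⊨ zrTheory r) (hr : IsAlmostSparse r) (z : ℤ →₀ ℤ) :
    ∃ k : ℕ, (∀ σ : ℤ → U, IsOrbit σ → σ (-k) < Finsupp.linearCombination ℤ σ z) ∨
      (∀ σ : ℤ → U, IsOrbit σ → σ (-k) < -Finsupp.linearCombination ℤ σ z) ∨
      (∀ σ : ℤ → U, IsOrbit σ → Finsupp.linearCombination ℤ σ z = 0) := by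
  have hneg : ∀ n, opEval r (-z) n = -opEval r z n := by simp [opEval_eq]
  have h0 : ∀ n, opEval r 0 n = 0 := by simp [opEval]
  rcases hr.trichotomy z 0 with h | h | h
  · obtain ⟨k, hk⟩ := orbit_growth (U := U) hU hr z (by simpa [h0] using h)
    exact ⟨k, Or.inl hk⟩
  · obtain ⟨k, hk⟩ := orbit_growth (U := U) hU hr (-z) (by simpa [h0, hneg] using h)
    exact ⟨k, Or.inr (Or.inl (by simpa using hk))⟩
  · refine ⟨0, Or.inr (Or.inr fun σ hσ => ?_)⟩
    rw [Nat.cofinite_eq_atTop, Filter.eventually_atTop] at h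
    obtain ⟨m, hm⟩ := h
    have h1 := orbit_pos_iff hU hr.strictMono z m False
      (fun n hn => by simp [hm n hn, h0]) σ hσ
    have h2 := orbit_pos_iff hU hr.strictMono (-z) m False
      (fun n hn => by simp [hneg, hm n hn, h0]) σ hσ
    simp only [map_neg, iff_false, not_lt] at h1 h2
    exact le_antisymm h1 (by simpa using h2)

lemma orbit_doubling (hU : U ⊨ zrTheory r) (hr : IsAlmostSparse r) :
    ∃ k : ℕ, ∀ σ : ℤ → U, IsOrbit σ → σ (-k) < σ 1 - σ 0 := by
  obtain ⟨k, hk⟩ := orbit_growth (U := U) hU hr (Finsupp.single 1 1 - Finsupp.single 0 1) (by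
    refine Filter.Eventually.of_forall fun n => ?_
    simp only [opEval_eq, map_sub, Finsupp.linearCombination_single, one_smul, sub_pos]
    exact hr.strictMono (by omega))
  exact ⟨k, fun σ hσ => by simpa using hk σ hσ⟩

end Window

/-! ### Properties used of the model; `λ`, `S` and `S⁻¹` in it -/

section SparseModel

/-- The facts about models of the theory of `(ℤ; <, +, R)` from which the back-and-forth property
is derived. -/
class IsSparseModel (U : Type u) [zrLang.Structure U] [AddCommGroup U] [LinearOrder U] : Prop
    extends IsGroupModel U where
  exists_one : ∃ e : U, 0 < e ∧ ∀ x, 0 < x → e ≤ x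
  exists_div : ∀ n : ℕ, n ≠ 0 → ∀ e : U, (0 < e ∧ ∀ x, 0 < x → e ≤ x) → ∀ x,
    ∃ y, 0 ≤ x - n • y ∧ x - n • y < n • e
  exists_least : ∃ x : U, MemR x ∧ ∀ y, MemR y → x ≤ y
  exists_lower : ∃ c : ℤ, ∀ e : U, (0 < e ∧ ∀ x, 0 < x → e ≤ x) → ∀ x, MemR x → c • e ≤ x
  exists_greatest : ∀ x s : U, MemR s → s ≤ x → ∃ m, MemR m ∧ m ≤ x ∧
    ∀ t, MemR t → t ≤ x → t ≤ m
  exists_next : ∀ x : U, MemR x → ∃ y, Next x y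
  exists_prev : ∀ x y : U, MemR x → MemR y → y < x → ∃ z, Next z x
  trichotomy : ∀ z : ℤ →₀ ℤ,
    ∃ k : ℕ, (∀ σ : ℤ → U, IsOrbit σ → σ (-k) < Finsupp.linearCombination ℤ σ z) ∨
      (∀ σ : ℤ → U, IsOrbit σ → σ (-k) < -Finsupp.linearCombination ℤ σ z) ∨
      (∀ σ : ℤ → U, IsOrbit σ → Finsupp.linearCombination ℤ σ z = 0)
  doubling : ∃ k : ℕ, ∀ σ : ℤ → U, IsOrbit σ → σ (-k) < σ 1 - σ 0

lemma isSparseModel {r : ℕ → ℤ} {U : Type u} [zrLang.Structure U] [AddCommGroup U] [LinearOrder U]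
    [IsOrderedAddMonoid U] [IsGroupModel U] (hU : U ⊨ zrTheory r) (hr : IsAlmostSparse r) :
    IsSparseModel U where
  exists_one := discrete hU
  exists_div := division_aux hU
  exists_least := exists_rMin hU hr.strictMono
  exists_lower := ⟨r 0, zsmul_le_of_memR_aux hU hr.strictMono⟩
  exists_greatest := exists_greatest_memR_le hU hr.strictMono
  exists_next := exists_next hU hr.strictMono
  exists_prev := exists_prev hU hr.strictMono
  trichotomy := orbit_trichotomy hU hr
  doubling := orbit_doubling hU hr

variable {U : Type u} [zrLang.Structure U] [AddCommGroup U] [LinearOrder U]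

lemma le_iff [IsGroupModel U] (x y : U) : Le x y ↔ x ≤ y := by
  rw [Le, IsGroupModel.lt_iff, le_iff_lt_or_eq]

lemma least_spec [IsGroupModel U] (P : U → Prop) (h : ∃ x, P x ∧ ∀ y, P y → x ≤ y) :
    P (least P) ∧ ∀ y, P y → least P ≤ y := by
  have := Classical.epsilon_spec (p := fun x => P x ∧ ∀ y, P y → Le x y)
    (by simpa only [le_iff] using h)
  simp only [le_iff] at this
  simpa only [least, greatest, le_iff] using this

lemma greatest_spec [IsGroupModel U] (P : U → Prop) (h : ∃ x, P x ∧ ∀ y, P y → y ≤ x) :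
    P (greatest P) ∧ ∀ y, P y → y ≤ greatest P := by
  have := Classical.epsilon_spec (p := fun x => P x ∧ ∀ y, P y → Le y x)
    (by simpa only [le_iff] using h)
  simp only [le_iff] at this
  simpa only [least, greatest, le_iff] using this

lemma zero_eq [IsGroupModel U] : zero U = 0 := by
  have h : ∀ y : U, AlmostSparse.add (zero U) y = y :=
    Classical.epsilon_spec (p := fun x : U => ∀ y, AlmostSparse.add x y = y)
      ⟨0, by simp [IsGroupModel.add_eq]⟩
  simpa [IsGroupModel.add_eq] using h 0

lemma neg_eq [IsGroupModel U] (x : U) : AlmostSparse.neg x = -x := by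
  have h : AlmostSparse.add x (AlmostSparse.neg x) = zero U :=
    Classical.epsilon_spec (p := fun y : U => AlmostSparse.add x y = zero U)
      ⟨-x, by simp [IsGroupModel.add_eq, zero_eq]⟩
  rw [IsGroupModel.add_eq, zero_eq] at h
  exact (neg_eq_of_add_eq_zero_right h).symm

lemma nmul_eq [IsGroupModel U] (n : ℕ) (x : U) : nmul n x = n • x := by
  induction n with
  | zero => simp [nmul, zero_eq]
  | succ n ih => rw [nmul, IsGroupModel.add_eq, ih, succ_nsmul]

lemma cong_iff [IsGroupModel U] (n i : ℕ) (x : U) : Cong n i x ↔ ∃ y, x = n • y + i • one U := by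
  simp only [Cong, nmul_eq, IsGroupModel.add_eq]

lemma next_iff [IsGroupModel U] (x y : U) :
    Next x y ↔ MemR x ∧ MemR y ∧ x < y ∧ ∀ t, MemR t → x < t → y ≤ t := by
  simp only [Next, IsGroupModel.lt_iff, not_lt]

variable [IsSparseModel U]

lemma one_spec : 0 < one U ∧ ∀ x, 0 < x → one U ≤ x := by
  have h := least_spec (fun x : U => Lt (zero U) x) (by
    simpa only [IsGroupModel.lt_iff, zero_eq] using IsSparseModel.exists_one)
  rw [← one] at h
  simpa only [IsGroupModel.lt_iff, zero_eq] using h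

lemma rMin_spec : MemR (rMin U) ∧ ∀ y : U, MemR y → rMin U ≤ y :=
  least_spec (fun x : U => MemR x) IsSparseModel.exists_least

lemma lam_of_lt (x : U) (h : x < rMin U) : lam x = rMin U := by
  rw [lam, if_neg]
  rw [le_iff]
  exact not_le.2 h

lemma lam_spec (x : U) (h : rMin U ≤ x) :
    MemR (lam x) ∧ lam x ≤ x ∧ ∀ t, MemR t → t ≤ x → t ≤ lam x := by
  have h1 := greatest_spec (fun s : U => MemR s ∧ Le s x) (by
    obtain ⟨m, h1, h2, h3⟩ := IsSparseModel.exists_greatest x (rMin U) rMin_spec.1 h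
    refine ⟨m, ⟨h1, (le_iff _ _).2 h2⟩, fun y hy => h3 y hy.1 ((le_iff _ _).1 hy.2)⟩)
  rw [lam, if_pos ((le_iff _ _).2 h)]
  exact ⟨h1.1.1, (le_iff _ _).1 h1.1.2, fun t ht htx => h1.2 t ⟨ht, (le_iff _ _).2 htx⟩⟩

lemma memR_lam (x : U) : MemR (lam x) := by
  rcases lt_or_ge x (rMin U) with h | h
  · rw [lam_of_lt x h]; exact rMin_spec.1
  · exact (lam_spec x h).1

lemma next_succ (x : U) : Next (lam x) (AlmostSparse.succ x) := by
  have h1 := least_spec (fun s : U => MemR s ∧ Lt (lam x) s) (by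
    obtain ⟨y, hy⟩ := IsSparseModel.exists_next (lam x) (memR_lam x)
    rw [next_iff] at hy
    exact ⟨y, ⟨hy.2.1, (IsGroupModel.lt_iff _ _).2 hy.2.2.1⟩,
      fun t ht => hy.2.2.2 t ht.1 ((IsGroupModel.lt_iff _ _).1 ht.2)⟩)
  rw [next_iff]
  exact ⟨memR_lam x, h1.1.1, (IsGroupModel.lt_iff _ _).1 h1.1.2,
    fun t ht hxt => h1.2 t ⟨ht, (IsGroupModel.lt_iff _ _).2 hxt⟩⟩

lemma Next.unique_right {x y z : U} (h : Next x y) (h' : Next x z) : y = z := by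
  rw [next_iff] at h h'
  exact le_antisymm (h.2.2.2 z h'.2.1 h'.2.2.1) (h'.2.2.2 y h.2.1 h.2.2.1)

lemma Next.unique_left {x y z : U} (h : Next x z) (h' : Next y z) : x = y := by
  rw [next_iff] at h h'
  rcases lt_trichotomy x y with hxy | hxy | hxy
  · exact absurd (h.2.2.2 y h'.1 hxy) (not_le.2 h'.2.2.1)
  · exact hxy
  · exact absurd (h'.2.2.2 x h.1 hxy) (not_le.2 h.2.2.1)

lemma lam_of_memR {x : U} (hx : MemR x) : lam x = x := by
  have h := lam_spec x (rMin_spec.2 x hx)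
  exact le_antisymm h.2.1 (h.2.2 x hx le_rfl)

lemma memR_iff_lam_eq (x : U) : MemR x ↔ lam x = x :=
  ⟨lam_of_memR, fun h => h ▸ memR_lam x⟩

lemma Next.succ_eq {x y : U} (h : Next x y) : AlmostSparse.succ x = y := by
  have h1 := next_succ x
  rw [lam_of_memR h.1] at h1
  exact h1.unique_right h

lemma succ_lam (x : U) : AlmostSparse.succ (lam x) = AlmostSparse.succ x :=
  (next_succ x).succ_eq

lemma pred_lam (x : U) : AlmostSparse.pred (lam x) = AlmostSparse.pred x := by
  rw [AlmostSparse.pred, AlmostSparse.pred, lam_of_memR (memR_lam x)]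

lemma next_pred {x : U} (hx : MemR x) (h : x ≠ rMin U) : Next (AlmostSparse.pred x) x := by
  obtain ⟨z, hz⟩ := IsSparseModel.exists_prev x (rMin U) hx rMin_spec.1
    (lt_of_le_of_ne (rMin_spec.2 x hx) h.symm)
  have hz' := hz
  rw [next_iff] at hz'
  have h1 := greatest_spec (fun s : U => MemR s ∧ Lt s (lam x)) (by
    refine ⟨z, ⟨hz.1, ?_⟩, ?_⟩
    · rw [lam_of_memR hx, IsGroupModel.lt_iff]; exact hz'.2.2.1
    · rintro y ⟨hy, hyx⟩
      rw [lam_of_memR hx, IsGroupModel.lt_iff] at hyx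
      by_contra hzy
      exact absurd (hz'.2.2.2 y hy (not_le.1 hzy)) (not_le.2 hyx))
  have h2 : AlmostSparse.pred x = greatest (fun s : U => MemR s ∧ Lt s (lam x)) := by
    rw [AlmostSparse.pred, if_neg]
    rwa [lam_of_memR hx]
  rw [← h2] at h1
  rw [lam_of_memR hx] at h1
  simp only [IsGroupModel.lt_iff] at h1
  rw [next_iff]
  refine ⟨h1.1.1, hx, h1.1.2, fun t ht hxt => ?_⟩
  by_contra htx
  exact absurd (h1.2 t ⟨ht, not_le.1 htx⟩) (not_le.2 hxt)

lemma Next.pred_eq {x y : U} (h : Next x y) : AlmostSparse.pred y = x := by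
  have hne : y ≠ rMin U := by
    rintro rfl
    exact absurd (rMin_spec.2 x h.1) (not_le.2 ((next_iff _ _).1 h).2.2.1)
  exact (next_pred h.2.1 hne).unique_left h

lemma lt_succ (x : U) : x < AlmostSparse.succ x := by
  have h1 := (next_iff _ _).1 (next_succ x)
  rcases lt_or_ge x (rMin U) with h | h
  · rw [lam_of_lt x h] at h1; exact h.trans h1.2.2.1
  · by_contra hx
    exact absurd ((lam_spec x h).2.2 _ h1.2.1 (not_lt.1 hx)) (not_le.2 h1.2.2.1)

lemma lam_eq_of_next {x s t : U} (h : Next s t) (h1 : s ≤ x) (h2 : x < t) : lam x = s := by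
  have hs := lam_spec x ((rMin_spec.2 s h.1).trans h1)
  refine le_antisymm ?_ (hs.2.2 s h.1 h1)
  by_contra hlt
  exact absurd (((next_iff _ _).1 h).2.2.2 _ hs.1 (not_le.1 hlt)) (not_le.2 (hs.2.1.trans_lt h2))

end SparseModel

/-! ### Elementary graphs and back-and-forth -/

section Elem

/-- The partial function with graph `G` is `L`-elementary. -/
def Elem (L : Language) {M : Type*} [L.Structure M] (G : Set (M × M)) : Prop :=
  ∀ (n : ℕ) (φ : L.Formula (Fin n)) (x : Fin n → M × M), (∀ i, x i ∈ G) →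
    (φ.Realize (fun i => (x i).2) ↔ φ.Realize (fun i => (x i).1))

variable {L : Language} {M : Type*} [L.Structure M] {G : Set (M × M)}

/-- A formula has finitely many free variables, so tuples indexed by `Fin n` suffice for an
arbitrary index type. -/
lemma Elem.realize_iff (h : Elem L G) {α : Type*} (φ : L.Formula α) (x : α → M × M)
    (hx : ∀ i, x i ∈ G) :
    φ.Realize (fun i => (x i).2) ↔ φ.Realize (fun i => (x i).1) := by
  classical
  let e := φ.freeVarFinset.equivFin
  have h1 := h _ (φ.restrictFreeVar e) (fun i => x (e.symm i)) fun i => hx _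
  rw [Formula.Realize, Formula.Realize,
    BoundedFormula.realize_restrictFreeVar (fun a => (x a).2) (by simp),
    BoundedFormula.realize_restrictFreeVar (fun a => (x a).1) (by simp)] at h1
  exact h1

lemma Elem.mono {G' : Set (M × M)} (h : Elem L G) (hG : G' ⊆ G) : Elem L G' :=
  fun n φ x hx => h n φ x fun i => hG (hx i)

lemma Elem.swap (h : Elem L G) : Elem L (Prod.swap ⁻¹' G) :=
  fun n φ x hx => (h n φ (fun i => (x i).swap) hx).symm

lemma Elem.eq_iff (h : Elem L G) {p q : M × M} (hp : p ∈ G) (hq : q ∈ G) :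
    p.2 = q.2 ↔ p.1 = q.1 := by
  have := h 2 (Term.equal (var 0) (var 1)) ![p, q] (by simp [Fin.forall_fin_two, hp, hq])
  simpa [Formula.realize_equal] using this

lemma Elem.sUnion {c : Set (Set (M × M))} (hc : IsChain (· ≤ ·) c) (hne : c.Nonempty)
    (h : ∀ G ∈ c, Elem L G) : Elem L (⋃₀ c) := by
  intro n φ x hx
  obtain ⟨G, hG, hxG⟩ := DirectedOn.exists_mem_subset_of_finite_of_subset_sUnion hne
    hc.directedOn (Set.finite_range x) (by rintro _ ⟨i, rfl⟩; exact hx i)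
  exact h G hG n φ x fun i => hxG ⟨i, rfl⟩

/-- The members of a back-and-forth system of graphs of partial functions are elementary. -/
lemma elem_of_backAndForth (I : Set (Set (M × M)))
    (hfun : ∀ G ∈ I, ∀ (n : ℕ) (F : L.Functions n) (x : Fin n → M × M), (∀ i, x i ∈ G) →
      (Structure.funMap F (fun i => (x i).1), Structure.funMap F (fun i => (x i).2)) ∈ G)
    (hrel : ∀ G ∈ I, ∀ (n : ℕ) (R : L.Relations n) (x : Fin n → M × M), (∀ i, x i ∈ G) →
      (Structure.RelMap R (fun i => (x i).2) ↔ Structure.RelMap R (fun i => (x i).1)))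
    (heq : ∀ G ∈ I, ∀ p ∈ G, ∀ q ∈ G, p.2 = q.2 ↔ p.1 = q.1)
    (forth : ∀ G ∈ I, ∀ a, ∃ G' ∈ I, G ⊆ G' ∧ ∃ b, (a, b) ∈ G')
    (back : ∀ G ∈ I, ∀ b, ∃ G' ∈ I, G ⊆ G' ∧ ∃ a, (a, b) ∈ G') :
    ∀ G ∈ I, Elem L G := by
  have hterm : ∀ G ∈ I, ∀ {γ : Type} (t : L.Term γ) (x : γ → M × M), (∀ i, x i ∈ G) →
      (t.realize (fun i => (x i).1), t.realize (fun i => (x i).2)) ∈ G := by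
    intro G hG γ t x hx
    induction t with
    | var i => exact hx i
    | func F ts ih => exact hfun G hG _ F _ ih
  have key : ∀ {α : Type} {n : ℕ} (φ : L.BoundedFormula α n), ∀ G ∈ I, ∀ (v : α → M × M)
      (x : Fin n → M × M), (∀ i, v i ∈ G) → (∀ i, x i ∈ G) →
      (φ.Realize (fun i => (v i).2) (fun i => (x i).2) ↔
        φ.Realize (fun i => (v i).1) (fun i => (x i).1)) := by
    intro α n φ
    have hel : ∀ {n : ℕ} (v : α → M × M) (x : Fin n → M × M),
        (Sum.elim (fun i => (v i).2) (fun i => (x i).2) = fun i => (Sum.elim v x i).2) ∧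
        (Sum.elim (fun i => (v i).1) (fun i => (x i).1) = fun i => (Sum.elim v x i).1) :=
      fun v x => ⟨funext (by rintro (i | i) <;> rfl), funext (by rintro (i | i) <;> rfl)⟩
    induction φ with
    | falsum => intros; rfl
    | equal t s =>
      intro G hG v x hv hx
      have hvx : ∀ i, Sum.elim v x i ∈ G := by rintro (i | i); exacts [hv i, hx i]
      simp only [BoundedFormula.Realize, hel]
      exact heq G hG _ (hterm G hG t _ hvx) _ (hterm G hG s _ hvx)
    | rel R ts =>
      intro G hG v x hv hx
      have hvx : ∀ i, Sum.elim v x i ∈ G := by rintro (i | i); exacts [hv i, hx i]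
      simp only [BoundedFormula.Realize, hel]
      exact hrel G hG _ R _ fun i => hterm G hG (ts i) _ hvx
    | imp φ ψ ih1 ih2 =>
      intro G hG v x hv hx
      rw [BoundedFormula.realize_imp, BoundedFormula.realize_imp, ih1 G hG v x hv hx,
        ih2 G hG v x hv hx]
    | all φ ih =>
      intro G hG v x hv hx
      rw [BoundedFormula.realize_all, BoundedFormula.realize_all]
      have hsnoc : ∀ G' ∈ I, G ⊆ G' → ∀ p ∈ G',
          (φ.Realize (fun i => (v i).2) (Fin.snoc (fun i => (x i).2) p.2) ↔
            φ.Realize (fun i => (v i).1) (Fin.snoc (fun i => (x i).1) p.1)) := by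
        intro G' hG' hGG' p hp
        have h1 := ih G' hG' v (Fin.snoc x p) (fun i => hGG' (hv i)) (by
          intro i
          refine Fin.lastCases ?_ (fun i => ?_) i
          · simpa using hp
          · simpa using hGG' (hx i))
        have h2 : ∀ {N : Type _} (f : M × M → N),
            (fun i => f ((Fin.snoc x p : Fin (_ + 1) → M × M) i)) =
              (Fin.snoc (fun i => f (x i)) (f p) : Fin (_ + 1) → N) := by
          intro N f
          funext i
          refine Fin.lastCases ?_ (fun i => ?_) i <;> simp
        rwa [h2 Prod.snd, h2 Prod.fst] at h1
      constructor
      · intro h a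
        obtain ⟨G', hG', hGG', b, hb⟩ := forth G hG a
        exact (hsnoc G' hG' hGG' _ hb).1 (h b)
      · intro h b
        obtain ⟨G', hG', hGG', a, ha⟩ := back G hG b
        exact (hsnoc G' hG' hGG' _ ha).2 (h a)
  intro G hG n φ x hx
  have := key φ G hG x (fun i => i.elim0) hx (fun i => i.elim0)
  simpa [Formula.Realize, Subsingleton.elim _ (default : Fin 0 → M)] using this

end Elem

/-! ### Saturation with parameters as free variables -/

section Saturation

lemma IsSaturated.exists_realize {κ : Cardinal.{u}} {U : Type u} [zrLang.Structure U]
    (hsat : IsSaturated zrLang κ U) {β ι : Type*} (w : β → U)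
    (hw : Cardinal.mk (Set.range w) < κ) (φ : ι → zrLang.Formula (β ⊕ Unit))
    (h : ∀ s : Finset ι, ∃ m : U, ∀ i ∈ s, (φ i).Realize (Sum.elim w fun _ => m)) :
    ∃ m : U, ∀ i, (φ i).Realize (Sum.elim w fun _ => m) := by
  classical
  let ψ : ι → (zrLang.withConstants (Set.range w)).Formula Unit := fun i =>
    BoundedFormula.constantsVarsEquiv.symm
      ((φ i).relabel (Sum.map (Set.rangeFactorization w) id))
  have hψ : ∀ i m, (ψ i).Realize (fun _ => m) ↔ (φ i).Realize (Sum.elim w fun _ => m) := by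
    intro i m
    rw [Formula.Realize, ← BoundedFormula.realize_constantsVarsEquiv, Equiv.apply_symm_apply,
      ← Formula.Realize, Formula.realize_relabel]
    have : (Sum.elim (fun a : Set.range w => ((zrLang.con a : zrLang[[Set.range w]].Constants) : U))
        fun _ : Unit => m) ∘ Sum.map (Set.rangeFactorization w) id = Sum.elim w fun _ => m := by
      funext j
      rcases j with j | j <;> simp
    rw [this]
  obtain ⟨m, hm⟩ := hsat (Set.range w) hw (Set.range ψ) (by
    intro s hs
    obtain ⟨t, rfl⟩ : ∃ t : Finset ι, t.image ψ = s := by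
      obtain ⟨t, -, ht⟩ := Finset.subset_set_image_iff.1
        (hs.trans (Set.image_univ (f := ψ)).ge)
      exact ⟨t, ht⟩
    obtain ⟨m, hm⟩ := h t
    refine ⟨m, fun χ hχ => ?_⟩
    obtain ⟨i, hi, rfl⟩ := Finset.mem_image.1 hχ
    exact (hψ i m).2 (hm i hi))
  exact ⟨m, fun i => (hψ i m).1 (hm _ ⟨i, rfl⟩)⟩

end Saturation

/-! ### Quantifier elimination for Presburger arithmetic, by back-and-forth -/

section Presburger

variable {U : Type u} [zrLang.Structure U] [AddCommGroup U] [LinearOrder U] [IsOrderedAddMonoid U]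
  [IsSparseModel U]

lemma eq_nsmul_one_of_lt (n : ℕ) (x : U) (h0 : 0 ≤ x) (h : x < n • one U) :
    ∃ i < n, x = i • one U := by
  induction n with
  | zero => simp at h; exact absurd h (not_lt.2 h0)
  | succ n ih =>
    rcases lt_or_ge x (n • one U) with hx | hx
    · obtain ⟨i, hi, rfl⟩ := ih hx
      exact ⟨i, by omega, rfl⟩
    · refine ⟨n, by omega, ?_⟩
      rw [succ_nsmul] at h
      rcases hx.eq_or_lt with hx | hx
      · exact hx.symm
      · have := one_spec.2 (x - n • one U) (sub_pos.2 hx)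
        grind

lemma exists_div (n : ℕ) (hn : n ≠ 0) (x : U) : ∃ y, ∃ i < n, x = n • y + i • one U := by
  obtain ⟨y, h1, h2⟩ := IsSparseModel.exists_div n hn (one U) one_spec x
  obtain ⟨i, hi, h⟩ := eq_nsmul_one_of_lt n _ h1 h2
  exact ⟨y, i, hi, by rw [← h]; abel⟩

/-- The graph of a partial isomorphism of subgroups of `(U; <, +, 1)` that preserves congruences. -/
structure PresSys (G : AddSubgroup (U × U)) : Prop where
  one_mem : (one U, one U) ∈ G
  pos : ∀ p ∈ G, 0 < p.1 ↔ 0 < p.2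
  div : ∀ p ∈ G, ∀ n : ℕ, n ≠ 0 → ∃ y, p.1 - p.2 = n • y

/-- The inverse of a graph. -/
def swapGraph (G : AddSubgroup (U × U)) : AddSubgroup (U × U) :=
  G.comap (AddEquiv.prodComm : U × U ≃+ U × U).toAddMonoidHom

lemma mk_swapGraph (G : AddSubgroup (U × U)) : Cardinal.mk (swapGraph G) = Cardinal.mk G :=
  Cardinal.mk_congr ⟨fun p => ⟨p.1.swap, p.2⟩, fun p => ⟨p.1.swap, p.2⟩, fun _ => rfl, fun _ => rfl⟩

lemma PresSys.swap {G : AddSubgroup (U × U)} (h : PresSys G) : PresSys (swapGraph G) where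
  one_mem := h.one_mem
  pos p hp := (h.pos _ hp).symm
  div p hp n hn := by
    obtain ⟨y, hy⟩ := h.div _ hp n hn
    exact ⟨-y, by rw [smul_neg, ← hy]; simp⟩

lemma PresSys.lt_iff {G : AddSubgroup (U × U)} (h : PresSys G) {p q : U × U} (hp : p ∈ G)
    (hq : q ∈ G) : p.1 < q.1 ↔ p.2 < q.2 := by
  have := h.pos _ (sub_mem hq hp)
  simpa using this

lemma PresSys.le_iff {G : AddSubgroup (U × U)} (h : PresSys G) {p q : U × U} (hp : p ∈ G)
    (hq : q ∈ G) : p.1 ≤ q.1 ↔ p.2 ≤ q.2 := by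
  rw [← not_lt, ← not_lt, h.lt_iff hq hp]

lemma PresSys.eq_iff {G : AddSubgroup (U × U)} (h : PresSys G) {p q : U × U} (hp : p ∈ G)
    (hq : q ∈ G) : p.1 = q.1 ↔ p.2 = q.2 := by
  rw [le_antisymm_iff, le_antisymm_iff, h.le_iff hp hq, h.le_iff hq hp]

lemma PresSys.diag_mem {G : AddSubgroup (U × U)} (h : PresSys G) (k : ℤ) :
    (k • one U, k • one U) ∈ G := by
  simpa using zsmul_mem h.one_mem k

/-- A finite part of the cut and congruence type of `a` over the domain of `G` is realized over
the image of `G`. -/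
lemma PresSys.exists_finite {G : AddSubgroup (U × U)} (h : PresSys G) (a : U) (M N : ℕ)
    (hM : M ≠ 0) (hN : N ≠ 0) (C : Finset (U × U)) (hC : ∀ c ∈ C, c ∈ G) :
    ∃ b, (∃ t, a - b = N • t) ∧ ∀ c ∈ C, (c.1 < M • a ↔ c.2 < M • b) := by
  -- Either `M • a` is at standard distance from some cut point, and then its image is forced, or
  -- every gap around it is infinite and leaves room for any residue.
  by_cases h1 : ∃ c ∈ C, ∃ k : ℤ, M • a = c.1 + k • one U
  · obtain ⟨c, hc, k, hk⟩ := h1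
    have hmem : (M • a, c.2 + k • one U) ∈ G := by
      have := add_mem (hC c hc) (h.diag_mem k)
      rwa [Prod.add_def, ← hk] at this
    -- Agreement modulo `M * N` makes the image of `M • a` equal to `M • (a - N • t)`, so it is
    -- divisible by `M` with quotient congruent to `a` modulo `N`.
    obtain ⟨t, ht⟩ := h.div _ hmem (M * N) (mul_ne_zero hM hN)
    have hb : M • (a - N • t) = c.2 + k • one U := by
      rw [smul_sub, smul_smul, ← ht]; simp
    refine ⟨a - N • t, ⟨t, by simp⟩, fun d hd => ?_⟩
    rw [hb]
    exact h.lt_iff (hC d hd) hmem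
  · push Not at h1
    have hfar : ∀ c ∈ C, ∀ k : ℕ, c.1 < M • a → c.1 + k • one U < M • a := by
      intro c hc k hlt
      by_contra hle
      obtain ⟨i, -, hi⟩ := eq_nsmul_one_of_lt (k + 1) (M • a - c.1) (sub_nonneg.2 hlt.le) (by
        have := (one_spec (U := U)).1
        rw [succ_nsmul]
        grind)
      exact h1 c hc i (by rw [natCast_zsmul, ← hi]; abel)
    -- `c₀` starts an interval of length `M * N` free of cut points: the largest cut point below `M
    -- • a`, or, if there is none, a point just over `M * N` below the least one.
    obtain ⟨c₀, hc₀, hlow, hhigh⟩ : ∃ c₀ ∈ G, (∀ c ∈ C, c.1 < M • a → c.1 ≤ c₀.1) ∧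
        ∀ c ∈ C, ¬ c.1 < M • a → c₀.1 + (M * N) • one U < c.1 := by
      rcases C.eq_empty_or_nonempty with rfl | hne
      · exact ⟨0, zero_mem _, by simp, by simp⟩
      by_cases hl : ∃ c ∈ C, c.1 < M • a
      · obtain ⟨c₀, hc₀, hmax⟩ := (C.filter fun c => c.1 < M • a).exists_max_image Prod.fst
          (by obtain ⟨c, hc, hc'⟩ := hl; exact ⟨c, by simp [hc, hc']⟩)
        rw [Finset.mem_filter] at hc₀
        refine ⟨c₀, hC _ hc₀.1, fun c hc hc' => hmax c (by simp [hc, hc']), fun c hc hc' => ?_⟩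
        exact (hfar c₀ hc₀.1 _ hc₀.2).trans_le (not_lt.1 hc')
      · push Not at hl
        obtain ⟨c₁, hc₁, hmin⟩ := C.exists_min_image Prod.fst hne
        refine ⟨c₁ - (((M * N + 1 : ℕ) : ℤ) • one U, ((M * N + 1 : ℕ) : ℤ) • one U),
          sub_mem (hC _ hc₁) (h.diag_mem _), fun c hc hc' => absurd hc' (not_lt.2 (hl c hc)),
          fun c hc _ => ?_⟩
        have h2 := hmin c hc
        have h3 := (one_spec (U := U)).1
        rw [natCast_zsmul, succ_nsmul, Prod.fst_sub]
        grind
    -- Among `M * N` consecutive elements after `c₀.2`, one is congruent to `M • a` modulo `M * N`;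
    -- it serves as `M • b`.
    obtain ⟨t, i, hi, ht⟩ := exists_div (M * N) (mul_ne_zero hM hN) (M • a - c₀.2 - one U)
    have hb : M • (a - N • t) = c₀.2 + one U + i • one U := by
      rw [smul_sub, smul_smul]
      generalize (M * N) • t = T at *
      grind
    refine ⟨a - N • t, ⟨t, by simp⟩, fun c hc => ?_⟩
    have h3 := (one_spec (U := U)).1
    rw [hb]
    by_cases hca : c.1 < M • a
    · have h4 := (h.le_iff (hC c hc) hc₀).1 (hlow c hc hca)
      have h5 : 0 ≤ i • one U := nsmul_nonneg h3.le i
      simp only [hca, true_iff]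
      grind
    · have h4 := (h.lt_iff (add_mem hc₀ (h.diag_mem (M * N : ℕ))) (hC c hc)).1 (by
        rw [Prod.fst_add, natCast_zsmul]; exact hhigh c hc hca)
      rw [Prod.snd_add, natCast_zsmul] at h4
      have h5 : (i + 1) • one U ≤ (M * N) • one U := nsmul_le_nsmul_left h3.le (by omega)
      rw [succ_nsmul] at h5
      simp only [hca, false_iff]
      grind

/-- Multiplication by `q` turns the coefficient into `±M`, so that finitely many inequalities become
cuts of one element `M • a`. For negative `m`, discreteness replaces a strict upper bound by the
negation of a strict lower bound. -/
lemma pos_iff_of_scaling (m : ℤ) (M q : ℕ) (hm : m ≠ 0) (hq : q ≠ 0) (hM : M = m.natAbs * q)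
    (a d : U) : 0 < m • a + d ↔
      if 0 < m then -(q • d) < M • a else ¬ q • d - one U < M • a := by
  have h1 : 0 < m • a + d ↔ 0 < q • (m • a + d) := (nsmul_pos_iff hq).symm
  have h3 : ∀ x : U, one U ≤ x ↔ 0 < x := fun x => ⟨one_spec.1.trans_le, one_spec.2 x⟩
  rw [h1, smul_add, ← natCast_zsmul (m • a) q, smul_smul]
  split_ifs with h
  · rw [show (q : ℤ) * m = (M : ℤ) by rw [hM]; push_cast; rw [abs_of_pos h]; ring, natCast_zsmul]
    generalize M • a = A
    grind
  · rw [show (q : ℤ) * m = -(M : ℤ) by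
      rw [hM]; push_cast; rw [abs_of_neg (by omega)]; ring, neg_smul, natCast_zsmul, not_lt,
      le_sub_comm, h3]
    generalize M • a = A
    grind

lemma mk_sup_lt {κ : Cardinal.{u}} (hκ : Cardinal.aleph0 ≤ κ) {A : Type u} [AddCommGroup A]
    (G H : AddSubgroup A) (hG : Cardinal.mk G < κ) (hH : Cardinal.mk H < κ) :
    Cardinal.mk ↥(G ⊔ H) < κ := by
  refine lt_of_le_of_lt ?_ (Cardinal.mul_lt_of_lt hκ hG hH)
  rw [Cardinal.mul_def]
  refine Cardinal.mk_le_of_surjective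
    (f := fun p : G × H => (⟨p.1 + p.2, AddSubgroup.add_mem_sup p.1.2 p.2.2⟩ : ↥(G ⊔ H))) ?_
  rintro ⟨x, hx⟩
  obtain ⟨y, hy, z, hz, rfl⟩ := AddSubgroup.mem_sup.1 hx
  exact ⟨(⟨y, hy⟩, ⟨z, hz⟩), rfl⟩

lemma mk_zmultiples_lt {κ : Cardinal.{u}} (hκ : Cardinal.aleph0 < κ) {A : Type u} [AddCommGroup A]
    (a : A) : Cardinal.mk (AddSubgroup.zmultiples a) < κ :=
  (Cardinal.mk_le_aleph0_iff.2 (Set.countable_range fun n : ℤ => n • a)).trans_lt hκ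

/-- The type to be realized prescribes the sign of every `m • b + d` and the residues of `b`. A
finite part reduces, over a common multiple of the coefficients and one of the moduli, to
`PresSys.exists_finite`. -/
lemma PresSys.exists_forth {κ : Cardinal.{u}} (hsat : IsSaturated zrLang κ U)
    {G : AddSubgroup (U × U)} (h : PresSys G) (hG : Cardinal.mk G < κ) (a : U) :
    ∃ b, PresSys (G ⊔ AddSubgroup.zmultiples (a, b)) := by
  classical
  choose y₀ i _ hi using fun n : ℕ => exists_div (n + 1) n.succ_ne_zero a
  let lin : ℤ × G → zrLang.Formula (G ⊕ Unit) := fun p =>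
    posF (var (Sum.inl (Sum.inr ())))
      [(p.1, var (Sum.inl (Sum.inr ()))), (1, var (Sum.inl (Sum.inl p.2)))]
  have hlin : ∀ p b, (lin p).Realize (Sum.elim (fun g : G => g.1.2) fun _ => b) ↔
      0 < p.1 • b + p.2.1.2 := by
    intro p b
    simp only [lin, Formula.Realize]
    rw [realize_posF]
    simp
  let one' : G := ⟨_, h.one_mem⟩
  -- Having no symbol for `0`, the formula carries an extra `1` on both sides.
  let cng : ℕ → zrLang.Formula (G ⊕ Unit) := fun n =>
    ∃' (nsmulAddT (L := zrLang) ZRFunc.add (var (Sum.inr 0))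
      (nsmulAddT (L := zrLang) ZRFunc.add (var (Sum.inl (Sum.inl one')))
        (var (Sum.inl (Sum.inl one'))) (i n)) (n + 1) =' addT (var (Sum.inl (Sum.inr ())))
          (var (Sum.inl (Sum.inl one'))))
  have hcng : ∀ n b, (cng n).Realize (Sum.elim (fun g : G => g.1.2) fun _ => b) ↔
      ∃ y, b = (n + 1) • y + i n • one U := by
    intro n b
    simp only [cng, Formula.Realize, BoundedFormula.realize_ex, BoundedFormula.realize_bdEqual]
    have hF : ∀ x y : U, Structure.funMap (L := zrLang) ZRFunc.add ![x, y] = x + y :=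
      IsGroupModel.add_eq
    simp only [realize_nsmulAddT hF, realize_addT, IsGroupModel.add_eq]
    simp only [Term.realize_var, Sum.elim_inl, Sum.elim_inr, one', ← add_assoc,
      add_left_inj, eq_comm (a := b)]
    simp [Fin.snoc]
  obtain ⟨b, hb⟩ := hsat.exists_realize (fun g : G => g.1.2)
    (Cardinal.mk_range_le.trans_lt hG)
    (Sum.elim (fun p : ℤ × G => if 0 < p.1 • a + p.2.1.1 then lin p else (lin p).not) cng) (by
    intro s
    let P : Finset (ℤ × G) := s.toLeft.filter fun p => p.1 ≠ 0
    let M : ℕ := ∏ p ∈ P, p.1.natAbs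
    let N : ℕ := ∏ n ∈ s.toRight, (n + 1)
    let q : ℤ × G → ℕ := fun p => M / p.1.natAbs
    have hM : M ≠ 0 := Finset.prod_ne_zero_iff.2 fun p hp => by
      simpa using (Finset.mem_filter.1 hp).2
    have hN : N ≠ 0 := Finset.prod_ne_zero_iff.2 fun n _ => n.succ_ne_zero
    have hq : ∀ p ∈ P, M = p.1.natAbs * q p := fun p hp =>
      (Nat.mul_div_cancel' (Finset.dvd_prod_of_mem _ hp)).symm
    let bd : ℤ × G → U × U := fun p =>
      if 0 < p.1 then -(q p • p.2.1) else q p • p.2.1 - (one U, one U)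
    obtain ⟨b, ⟨t, ht⟩, hb⟩ := h.exists_finite a M N hM hN (P.image bd) (by
      intro c hc
      obtain ⟨p, -, rfl⟩ := Finset.mem_image.1 hc
      simp only [bd]
      split_ifs
      · exact neg_mem (nsmul_mem p.2.2 _)
      · exact sub_mem (nsmul_mem p.2.2 _) h.one_mem)
    refine ⟨b, ?_⟩
    rintro (p | n) hp
    · have key : 0 < p.1 • a + p.2.1.1 ↔ 0 < p.1 • b + p.2.1.2 := by
        by_cases hp0 : p.1 = 0
        · simpa [hp0] using h.pos _ p.2.2
        · have hpP : p ∈ P := by simp [P, hp, hp0]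
          have hq0 : q p ≠ 0 := fun h0 => hM (by rw [hq p hpP, h0, mul_zero])
          have h1 := hb _ (Finset.mem_image_of_mem bd hpP)
          rw [pos_iff_of_scaling p.1 M (q p) hp0 hq0 (hq p hpP),
            pos_iff_of_scaling p.1 M (q p) hp0 hq0 (hq p hpP)]
          simp only [bd] at h1
          split_ifs with h2
          · simpa [h2] using h1
          · simpa [h2] using not_congr h1
      simp only [Sum.elim_inl]
      split_ifs with h1
      · exact (hlin p b).2 (key.1 h1)
      · exact (Formula.realize_not).2 fun h2 => h1 (key.2 ((hlin p b).1 h2))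
    · simp only [Sum.elim_inr]
      rw [hcng]
      obtain ⟨k, hk⟩ : (n + 1) ∣ N := Finset.dvd_prod_of_mem (fun n => n + 1) (by simpa using hp)
      -- Since `a - b = N • t` and `N = (n + 1) * k`, passing from `a` to `b` shifts the quotient by
      -- `k • t`.
      refine ⟨y₀ n - k • t, ?_⟩
      rw [smul_sub, smul_smul, ← hk, ← ht]
      have := hi n
      generalize (n + 1) • y₀ n = Y at *
      grind)
  refine ⟨b, h.one_mem |> fun h1 => AddSubgroup.mem_sup_left h1, ?_, ?_⟩
  · intro p hp
    obtain ⟨d, hd, z, hz, rfl⟩ := AddSubgroup.mem_sup.1 hp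
    obtain ⟨m, rfl⟩ := AddSubgroup.mem_zmultiples_iff.1 hz
    have h1 := hb (Sum.inl (m, ⟨d, hd⟩))
    simp only [Sum.elim_inl] at h1
    simp only [Prod.fst_add, Prod.smul_fst, Prod.snd_add, Prod.smul_snd]
    rw [add_comm d.1, add_comm d.2]
    split_ifs at h1 with h2
    · exact iff_of_true h2 ((hlin _ _).1 h1)
    · exact iff_of_false h2 fun h3 => Formula.realize_not.1 h1 ((hlin _ _).2 h3)
  · intro p hp n hn
    obtain ⟨d, hd, z, hz, rfl⟩ := AddSubgroup.mem_sup.1 hp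
    obtain ⟨m, rfl⟩ := AddSubgroup.mem_zmultiples_iff.1 hz
    obtain ⟨y, hy⟩ := h.div d hd n hn
    obtain ⟨k, rfl⟩ := Nat.exists_eq_succ_of_ne_zero hn
    obtain ⟨y', hy'⟩ := (hcng _ _).1 (hb (Sum.inr k))
    refine ⟨y + m • (y₀ k - y'), ?_⟩
    simp only [Prod.fst_add, Prod.smul_fst, Prod.snd_add, Prod.smul_snd]
    rw [smul_add, smul_comm, smul_sub, Nat.succ_eq_add_one, add_sub_add_comm, ← smul_sub, hy]
    congr 2
    rw [hi k, hy']
    abel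

lemma PresSys.elem {κ : Cardinal.{u}} (hκ : Cardinal.aleph0 < κ) (hsat : IsSaturated zrLang κ U)
    {G : AddSubgroup (U × U)} (h : PresSys G) (hG : Cardinal.mk G < κ) :
    Elem presLang (G : Set (U × U)) := by
  have forth : ∀ G : AddSubgroup (U × U), PresSys G → Cardinal.mk G < κ → ∀ a : U,
      ∃ G', PresSys G' ∧ Cardinal.mk G' < κ ∧ G ≤ G' ∧ ∃ b, (a, b) ∈ G' := by
    intro G h hG a
    obtain ⟨b, hb⟩ := h.exists_forth hsat hG a
    exact ⟨_, hb, mk_sup_lt hκ.le _ _ hG (mk_zmultiples_lt hκ _), le_sup_left, b,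
      AddSubgroup.mem_sup_right (AddSubgroup.mem_zmultiples _)⟩
  refine elem_of_backAndForth
    {S | ∃ G : AddSubgroup (U × U), PresSys G ∧ Cardinal.mk G < κ ∧ (G : Set (U × U)) = S}
    ?_ ?_ ?_ ?_ ?_ _ ⟨G, h, hG, rfl⟩
  · rintro _ ⟨G, h, hG, rfl⟩ n F x hx
    cases F
    change (AlmostSparse.add _ _, AlmostSparse.add _ _) ∈ G
    simp only [IsGroupModel.add_eq]
    exact add_mem (hx 0) (hx 1)
  · rintro _ ⟨G, h, hG, rfl⟩ n R x hx
    cases R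
    change Lt _ _ ↔ Lt _ _
    simpa only [IsGroupModel.lt_iff] using (h.lt_iff (hx 0) (hx 1)).symm
  · rintro _ ⟨G, h, hG, rfl⟩ p hp q hq
    exact (h.eq_iff hp hq).symm
  · rintro _ ⟨G, h, hG, rfl⟩ a
    obtain ⟨G', h1, h2, h3, h4⟩ := forth G h hG a
    exact ⟨G', ⟨G', h1, h2, rfl⟩, h3, h4⟩
  · rintro _ ⟨G, h, hG, rfl⟩ b
    obtain ⟨G', h1, h2, h3, a, h4⟩ := forth _ h.swap (by rwa [mk_swapGraph]) b
    exact ⟨swapGraph G', ⟨_, h1.swap, by rwa [mk_swapGraph], rfl⟩, fun p hp => h3 hp, a, h4⟩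

/-- With `1` fixed, the residue of `p.1` is expressible in `{<, +}`, so `p.2` has the same one. -/
lemma exists_div_of_elem {G : Set (U × U)} (h : Elem presLang G) (h1 : (one U, one U) ∈ G)
    (p : U × U) (hp : p ∈ G) (n : ℕ) (hn : n ≠ 0) : ∃ y, p.1 - p.2 = n • y := by
  obtain ⟨y, i, -, hi⟩ := exists_div n hn p.1
  let φ : presLang.Formula (Fin 2) :=
    ∃' (nsmulAddT (L := presLang) PresFunc.add (var (Sum.inr 0))
      (nsmulAddT (L := presLang) PresFunc.add (var (Sum.inl 1))
        (var (Sum.inl 1)) i) n =' Functions.apply₂ (L := presLang) PresFunc.add (var (Sum.inl 0))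
          (var (Sum.inl 1)))
  have hφ : ∀ v : Fin 2 → U, φ.Realize v ↔ ∃ y, n • y + i • v 1 = v 0 := by
    intro v
    simp only [φ, Formula.Realize, BoundedFormula.realize_ex, BoundedFormula.realize_bdEqual]
    have hF : ∀ x y : U, Structure.funMap (L := presLang) PresFunc.add ![x, y] = x + y :=
      IsGroupModel.add_eq
    have hT : ∀ (t s : presLang.Term (Fin 2 ⊕ Fin 1)) (v : Fin 2 ⊕ Fin 1 → U),
        (Functions.apply₂ (L := presLang) PresFunc.add t s).realize v =
          t.realize v + s.realize v :=
      fun _ _ _ => Term.realize_functions_apply₂.trans (hF _ _)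
    simp only [realize_nsmulAddT hF, hT]
    simp only [Term.realize_var, Sum.elim_inl, Sum.elim_inr, ← add_assoc, add_left_inj]
    simp [Fin.snoc]
  have h2 := h 2 φ ![p, (one U, one U)] (by simp [Fin.forall_fin_two, hp, h1])
  rw [hφ, hφ] at h2
  obtain ⟨y', hy'⟩ := h2.2 ⟨y, by simpa using hi.symm⟩
  simp only [Matrix.cons_val_one, Matrix.cons_val_zero] at hy'
  refine ⟨y - y', ?_⟩
  rw [smul_sub, hi, ← hy']
  abel

end Presburger

/-! ### Elementary maps on `R` with order and residues -/

section Residues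

variable {U : Type u} [zrLang.Structure U] [AddCommGroup U] [LinearOrder U] [IsOrderedAddMonoid U]
  [IsSparseModel U]

/-- The formula `t ≡ i (mod m)`. -/
def congF {α : Type*} {n : ℕ} (m i : ℕ) (j : α ⊕ Fin n) : zrLang.BoundedFormula α n :=
  ∃' ((posF (&(Fin.last n)) [(1, &(Fin.last n))] ⊓
    ∀' ((posF (&(Fin.last (n + 1))) [(1, &(Fin.last (n + 1)))]).imp
      (ltF (&(Fin.last (n + 1))) (&(Fin.last n).castSucc)).not)) ⊓
    ∃' (nsmulAddT (L := zrLang) ZRFunc.add (&(Fin.last (n + 1)))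
      (nsmulAddT (L := zrLang) ZRFunc.add (&(Fin.last n).castSucc) (&(Fin.last n).castSucc) i) m ='
        addT (var (Sum.map id (fun k => k.castSucc.castSucc) j)) (&(Fin.last n).castSucc)))

omit [IsSparseModel U] in
lemma isLeast_pos_unique {e e' : U} (h : 0 < e ∧ ∀ x, 0 < x → e ≤ x)
    (h' : 0 < e' ∧ ∀ x, 0 < x → e' ≤ x) : e = e' :=
  le_antisymm (h.2 _ h'.1) (h'.2 _ h.1)

lemma realize_congF {α : Type*} {n : ℕ} (m i : ℕ) (j : α ⊕ Fin n) (v : α → U) (xs : Fin n → U) :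
    (congF m i j).Realize v xs ↔ Cong m i (Sum.elim v xs j) := by
  have hF : ∀ x y : U, Structure.funMap (L := zrLang) ZRFunc.add ![x, y] = x + y :=
    IsGroupModel.add_eq
  have hj : ∀ e y : U, Sum.elim v (Fin.snoc (Fin.snoc xs e : Fin (n + 1) → U) y : Fin (n + 2) → U)
      (Sum.map id (fun k => k.castSucc.castSucc) j) = Sum.elim v xs j := by
    intro e y; cases j <;> simp
  rw [cong_iff]
  simp only [congF, BoundedFormula.realize_ex, BoundedFormula.realize_inf,
    BoundedFormula.realize_bdEqual, realize_nsmulAddT hF, realize_addT, IsGroupModel.add_eq,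
    Term.realize_var, hj, BoundedFormula.realize_all, BoundedFormula.realize_imp,
    BoundedFormula.realize_not, realize_posF, realize_ltF, IsGroupModel.lt_iff, Function.comp_apply,
    Sum.elim_inr, Fin.snoc_last, Fin.snoc_castSucc, List.map_cons, List.map_nil, List.sum_cons,
    List.sum_nil, one_smul, add_zero, not_lt, ← add_assoc, add_left_inj]
  constructor
  · rintro ⟨e, he, y, hy⟩
    rw [isLeast_pos_unique he one_spec] at hy
    exact ⟨y, hy.symm⟩
  · rintro ⟨y, hy⟩
    exact ⟨one U, one_spec, y, hy.symm⟩

/-- Order and congruences are definable in `{<, +, R}`, and quantifiers can be bounded by `R`. Hence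
saturation of `U` can be applied to types in the structure on `R`. -/
lemma exists_relativization {α : Type*} {n : ℕ} (φ : resLang.BoundedFormula α n) :
    ∃ ψ : zrLang.BoundedFormula α n, ∀ (v : α → RSet U) (xs : Fin n → RSet U),
      ψ.Realize (fun i => (v i).1) (fun i => (xs i).1) ↔ φ.Realize v xs := by
  have hterm : ∀ {γ : Type _} (t : resLang.Term γ), ∃ j, t = var j := by
    rintro γ (j | ⟨F, _⟩)
    · exact ⟨j, rfl⟩
    · exact F.elim
  have hel : ∀ {n : ℕ} (v : α → RSet U) (xs : Fin n → RSet U) (j : α ⊕ Fin n),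
      Sum.elim (fun i => (v i).1) (fun i => (xs i).1) j = (Sum.elim v xs j).1 := by
    intro n v xs j; cases j <;> rfl
  induction φ with
  | falsum => exact ⟨⊥, fun _ _ => Iff.rfl⟩
  | equal t s =>
    obtain ⟨j, rfl⟩ := hterm t
    obtain ⟨k, rfl⟩ := hterm s
    refine ⟨(var j).bdEqual (var k), fun v xs => ?_⟩
    simp only [BoundedFormula.realize_bdEqual, BoundedFormula.Realize, Term.realize_var, hel]
    exact Subtype.ext_iff.symm
  | rel R ts =>
    obtain ⟨js, hjs⟩ : ∃ js : _ → _, ∀ i, ts i = var (js i) := ⟨_, fun i => (hterm (ts i)).choose_spec⟩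
    cases R with
    | lt =>
      refine ⟨ltF (var (js 0)) (var (js 1)), fun v xs => ?_⟩
      simp only [realize_ltF, BoundedFormula.Realize, Term.realize_var, hel, hjs]
      rfl
    | cong m i hm hi =>
      refine ⟨congF m i (js 0), fun v xs => ?_⟩
      simp only [realize_congF, BoundedFormula.Realize, Term.realize_var, hel, hjs]
      rfl
  | imp φ χ ih1 ih2 =>
    obtain ⟨ψ1, h1⟩ := ih1
    obtain ⟨ψ2, h2⟩ := ih2
    exact ⟨ψ1.imp ψ2, fun v xs => by simp only [BoundedFormula.realize_imp, h1, h2]⟩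
  | @all n φ ih =>
    obtain ⟨ψ, h⟩ := ih
    refine ⟨∀' ((memF (&(Fin.last n))).imp ψ), fun v xs => ?_⟩
    have hsnoc : ∀ a : RSet U, (Fin.snoc (fun i => (xs i).1) a.1 : Fin (n + 1) → U) =
        fun i => ((Fin.snoc xs a : Fin (n + 1) → RSet U) i).1 := by
      intro a
      funext i
      refine Fin.lastCases ?_ (fun i => ?_) i <;> simp
    simp only [BoundedFormula.realize_all, BoundedFormula.realize_imp, realize_memF,
      Term.realize_var, Function.comp_apply, Sum.elim_inr, Fin.snoc_last]
    constructor
    · intro h' a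
      rw [← h, ← hsnoc]
      exact h' a.1 a.2
    · intro h' a ha
      have := (h v _).2 (h' ⟨a, ha⟩)
      rw [← hsnoc ⟨a, ha⟩] at this
      exact this

/-- The type of `a` over the domain of `h`, carried along `h`, is finitely satisfiable because `h`
preserves existential formulas. -/
lemma Elem.exists_insert {κ : Cardinal.{u}} (hsat : IsSaturated zrLang κ U)
    {h : Set (RSet U × RSet U)} (he : Elem resLang h) (hh : Cardinal.mk h < κ) (a : RSet U) :
    ∃ b, Elem resLang (insert (a, b) h) := by
  classical
  let ι := {φ : resLang.Formula (h ⊕ Unit) // φ.Realize (Sum.elim (fun p => p.1.1) fun _ => a)}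
  choose ψ hψ using fun φ : resLang.Formula (h ⊕ Unit) => exists_relativization (U := U) φ
  have hel : ∀ b : RSet U, (Sum.elim (fun p : h => p.1.2.1) fun _ : Unit => b.1) =
      fun i => (Sum.elim (fun p : h => p.1.2) (fun _ : Unit => b) i).1 :=
    fun b => funext fun i => by cases i <;> rfl
  have hreal : ∀ (φ : resLang.Formula (h ⊕ Unit)) (b : RSet U),
      (memF (n := 0) (var (Sum.inl (Sum.inr ()))) ⊓ ψ φ).Realize
        (Sum.elim (fun p : h => p.1.2.1) fun _ : Unit => b.1) default ↔
      φ.Realize (Sum.elim (fun p => p.1.2) fun _ => b) := by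
    intro φ b
    rw [BoundedFormula.realize_inf, realize_memF, Term.realize_var, hel, Formula.Realize, ← hψ,
      Subsingleton.elim (fun i : Fin 0 => ((default : Fin 0 → RSet U) i).1) default]
    exact and_iff_right b.2
  obtain ⟨b, hb⟩ := hsat.exists_realize (fun p : h => p.1.2.1)
    (Cardinal.mk_range_le.trans_lt hh)
    (fun φ : ι => memF (n := 0) (var (Sum.inl (Sum.inr ()))) ⊓ ψ φ.1) (by
      intro s
      have h1 := he.realize_iff
        ((Formula.iInf fun φ : s => φ.1.1).iExs Unit : resLang.Formula h) (fun p => p.1)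
        fun p => p.2
      simp only [Formula.realize_iExs, Formula.realize_iInf] at h1
      obtain ⟨b, hb⟩ := h1.2 ⟨fun _ => a, fun φ => φ.1.2⟩
      exact ⟨(b ()).1, fun φ hφ => (hreal φ.1 (b ())).2 (hb ⟨φ, hφ⟩)⟩)
  have hbR : MemR b := by
    -- Any member of the type would do: each conjunction contains the clause that the realization
    -- lies in `R`.
    have h1 := hb ⟨⊤, Formula.realize_top.2 trivial⟩
    exact (realize_memF _ _ _).1 (BoundedFormula.realize_inf.1 h1).1
  refine ⟨⟨b, hbR⟩, ?_⟩
  have key : ∀ φ : resLang.Formula (h ⊕ Unit),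
      φ.Realize (Sum.elim (fun p => p.1.1) fun _ => a) →
        φ.Realize (Sum.elim (fun p => p.1.2) fun _ => ⟨b, hbR⟩) := fun φ hφ =>
    (hreal φ ⟨b, hbR⟩).1 (hb ⟨φ, hφ⟩)
  intro n θ x hx
  let g : Fin n → h ⊕ Unit := fun i => if hi : x i ∈ h then Sum.inl ⟨x i, hi⟩ else Sum.inr ()
  have hg : ∀ i, (Sum.elim (fun p : h => p.1) (fun _ : Unit => (a, (⟨b, hbR⟩ : RSet U))) (g i)) =
      x i := by
    intro i
    by_cases hi : x i ∈ h
    · simp [g, hi]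
    · simp only [g, hi, dite_false, Sum.elim_inr]
      exact ((Set.mem_insert_iff.1 (hx i)).resolve_right hi).symm
  have h1 : (Sum.elim (fun p : h => p.1.1) fun _ : Unit => a) ∘ g = fun i => (x i).1 := by
    funext i
    rw [← hg i, Function.comp_apply]
    cases g i <;> rfl
  have h2 : (Sum.elim (fun p : h => p.1.2) fun _ : Unit => (⟨b, hbR⟩ : RSet U)) ∘ g =
      fun i => (x i).2 := by
    funext i
    rw [← hg i, Function.comp_apply]
    cases g i <;> rfl
  have h3 := key (θ.relabel g)
  -- The type is complete, so applying `key` to the negation gives the converse implication.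
  have h4 := key (θ.relabel g).not
  rw [Formula.realize_not, Formula.realize_not] at h4
  rw [Formula.realize_relabel, Formula.realize_relabel, h1, h2] at h3 h4
  exact ⟨fun h => by_contra fun h' => h4 h' h, h3⟩

lemma mk_lt_of_functional {κ : Cardinal.{u}} {A B : Type u} {h : Set (A × B)} {T : Set A}
    (hT : Cardinal.mk T < κ) (hdom : ∀ p ∈ h, p.1 ∈ T)
    (hfun : ∀ p ∈ h, ∀ q ∈ h, p.1 = q.1 → p.2 = q.2) : Cardinal.mk h < κ := by
  refine (Cardinal.mk_le_of_injective (f := fun p : h => (⟨p.1.1, hdom _ p.2⟩ : T)) ?_).trans_lt hT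
  rintro ⟨p, hp⟩ ⟨q, hq⟩ hpq
  have h1 : p.1 = q.1 := congrArg Subtype.val hpq
  exact Subtype.ext (Prod.ext h1 (hfun p hp q hq h1))

/-- Zorn's lemma: a maximal elementary extension inside `T` is functional, hence no larger than `T`,
so `Elem.exists_insert` still applies to it. -/
lemma Elem.exists_total {κ : Cardinal.{u}} (hsat : IsSaturated zrLang κ U)
    {h₀ : Set (RSet U × RSet U)} (he : Elem resLang h₀) (T : Set (RSet U))
    (hT : Cardinal.mk T < κ) (hdom : ∀ p ∈ h₀, p.1 ∈ T) :
    ∃ h, h₀ ⊆ h ∧ Elem resLang h ∧ ∀ a ∈ T, ∃ b, (a, b) ∈ h := by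
  obtain ⟨h, hh, hmax⟩ := zorn_le_nonempty₀
    {h : Set (RSet U × RSet U) | Elem resLang h ∧ ∀ p ∈ h, p.1 ∈ T} (by
      intro c hc hchain y hy
      refine ⟨⋃₀ c, ⟨Elem.sUnion hchain ⟨y, hy⟩ fun G hG => (hc hG).1, ?_⟩,
        fun z hz => Set.subset_sUnion_of_mem hz⟩
      rintro p ⟨G, hG, hp⟩
      exact (hc hG).2 p hp) h₀ ⟨he, hdom⟩
  refine ⟨h, hh, hmax.1.1, fun a ha => ?_⟩
  obtain ⟨b, hb⟩ := hmax.1.1.exists_insert hsat (mk_lt_of_functional hT hmax.1.2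
    fun p hp q hq => (hmax.1.1.eq_iff hp hq).2) a
  refine ⟨b, hmax.2 (y := insert (a, b) h) ⟨hb, ?_⟩ (Set.subset_insert _ _) (Set.mem_insert _ _)⟩
  rintro p (rfl | hp)
  · exact ha
  · exact hmax.1.2 p hp

/-- The formula `t < s` of `resLang`. -/
def resLtF {α : Type*} {n : ℕ} (t s : α ⊕ Fin n) : resLang.BoundedFormula α n :=
  Relations.boundedFormula₂ (L := resLang) ResRel.lt (var t) (var s)

lemma realize_resLtF {α : Type*} {n : ℕ} (t s : α ⊕ Fin n) (v : α → RSet U) (xs : Fin n → RSet U) :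
    (resLtF t s).Realize v xs ↔ (Sum.elim v xs t).1 < (Sum.elim v xs s).1 := by
  rw [← IsGroupModel.lt_iff]
  exact BoundedFormula.realize_rel₂

lemma Elem.res_lt_iff {h : Set (RSet U × RSet U)} (he : Elem resLang h) {p q : RSet U × RSet U}
    (hp : p ∈ h) (hq : q ∈ h) : p.2.1 < q.2.1 ↔ p.1.1 < q.1.1 := by
  have := he 2 (resLtF (Sum.inl 0) (Sum.inl 1)) ![p, q] (by simp [Fin.forall_fin_two, hp, hq])
  rwa [Formula.Realize, Formula.Realize, realize_resLtF, realize_resLtF] at this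

lemma Elem.res_cong_iff {h : Set (RSet U × RSet U)} (he : Elem resLang h) {p : RSet U × RSet U}
    (hp : p ∈ h) (n i : ℕ) (hn : 2 ≤ n) (hi : i < n) : Cong n i p.2.1 ↔ Cong n i p.1.1 := by
  have := he 1 (Relations.formula₁ (L := resLang) (ResRel.cong n i hn hi) (var 0)) ![p]
    (by simp [hp])
  exact Formula.realize_rel₁.symm.trans (this.trans Formula.realize_rel₁)

lemma Elem.res_div {h : Set (RSet U × RSet U)} (he : Elem resLang h) {p : RSet U × RSet U}
    (hp : p ∈ h) (n : ℕ) (hn : n ≠ 0) : ∃ y, p.1.1 - p.2.1 = n • y := by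
  rcases Nat.lt_or_ge n 2 with h2 | h2
  · obtain rfl : n = 1 := by omega
    exact ⟨_, (one_smul ℕ _).symm⟩
  · obtain ⟨y, i, hi, hy⟩ := exists_div n hn p.1.1
    obtain ⟨y', hy'⟩ := (cong_iff _ _ _).1
      ((he.res_cong_iff hp n i h2 hi).2 ((cong_iff _ _ _).2 ⟨y, hy⟩))
    exact ⟨y - y', by rw [hy, hy', smul_sub]; abel⟩

/-- Succession in `R` is definable from the order of `R` alone. -/
lemma Elem.res_next {h : Set (RSet U × RSet U)} (he : Elem resLang h) {p q : RSet U × RSet U}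
    (hp : p ∈ h) (hq : q ∈ h) (hn : Next p.1.1 q.1.1) : Next p.2.1 q.2.1 := by
  let φ : resLang.Formula (Fin 2) :=
    resLtF (Sum.inl 0) (Sum.inl 1) ⊓
      ∀' ((resLtF (Sum.inl 0) (Sum.inr 0)).imp (resLtF (Sum.inr 0) (Sum.inl 1)).not)
  have hφ : ∀ v : Fin 2 → RSet U, φ.Realize v ↔ Next (v 0).1 (v 1).1 := by
    intro v
    simp only [φ, Formula.Realize, BoundedFormula.realize_inf, BoundedFormula.realize_all,
      BoundedFormula.realize_imp, BoundedFormula.realize_not, realize_resLtF, next_iff, not_lt]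
    exact ⟨fun h => ⟨(v 0).2, (v 1).2, h.1, fun t ht => h.2 ⟨t, ht⟩⟩,
      fun h => ⟨h.2.2.1, fun a => h.2.2.2 a.1 a.2⟩⟩
  have := he 2 φ ![p, q] (by simp [Fin.forall_fin_two, hp, hq])
  rw [hφ, hφ] at this
  exact this.2 hn

end Residues

/-! ### Size and position of `ℤ`-orbits -/

section Orbits

variable {U : Type u} [zrLang.Structure U] [AddCommGroup U] [LinearOrder U] [IsOrderedAddMonoid U]
  [IsSparseModel U] {σ : ℤ → U}

/-- As `X` avoids `r₀`, the iteration of `S⁻¹` never becomes stationary. -/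
lemma exists_orbit (X : U → Prop)
    (hX : ∀ x, X x → MemR x ∧ x ≠ rMin U ∧ X (AlmostSparse.succ x) ∧ X (AlmostSparse.pred x))
    (a : U) (ha : X a) : ∃ σ : ℤ → U, σ 0 = a ∧ IsOrbit σ ∧ ∀ i, X (σ i) := by
  have hs : ∀ n, X (AlmostSparse.succ^[n] a) := by
    intro n
    induction n with
    | zero => exact ha
    | succ n ih => rw [Function.iterate_succ_apply']; exact (hX _ ih).2.2.1
  have hp : ∀ n, X (AlmostSparse.pred^[n] a) := by
    intro n
    induction n with
    | zero => exact ha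
    | succ n ih => rw [Function.iterate_succ_apply']; exact (hX _ ih).2.2.2
  have hns : ∀ x, X x → Next x (AlmostSparse.succ x) := by
    intro x hx
    have := next_succ x
    rwa [lam_of_memR (hX x hx).1] at this
  refine ⟨fun i => Int.casesOn i (fun n => AlmostSparse.succ^[n] a)
    fun n => AlmostSparse.pred^[n + 1] a, rfl, ?_, ?_⟩
  · rintro (n | n)
    · change Next _ (AlmostSparse.succ^[n + 1] a)
      rw [Function.iterate_succ_apply']
      exact hns _ (hs n)
    · have h1 : Next (AlmostSparse.pred^[n + 1] a) (AlmostSparse.pred^[n] a) := by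
        rw [Function.iterate_succ_apply']
        exact next_pred (hX _ (hp n)).1 (hX _ (hp n)).2.1
      cases n with
      | zero => exact h1
      | succ n => exact h1
  · rintro (n | n)
    · exact hs n
    · exact hp (n + 1)

omit [IsSparseModel U] [IsOrderedAddMonoid U] in
lemma IsOrbit.memR (hσ : IsOrbit σ) (i : ℤ) : MemR (σ i) := (hσ i).1

lemma IsOrbit.strictMono (hσ : IsOrbit σ) : StrictMono σ :=
  strictMono_int_of_lt_succ fun i => ((next_iff _ _).1 (hσ i)).2.2.1

lemma IsOrbit.shift (hσ : IsOrbit σ) (j : ℤ) : IsOrbit fun i => σ (i + j) := by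
  intro i
  have := hσ (i + j)
  rwa [show i + j + 1 = i + 1 + j by ring] at this

lemma IsOrbit.add_nsmul_le (hσ : IsOrbit σ) (i : ℤ) (n : ℕ) : σ i + n • one U ≤ σ (i + n) := by
  induction n with
  | zero => simp
  | succ n ih =>
    have h1 := hσ.strictMono (show i + n < i + (n + 1 : ℕ) by push_cast; omega)
    have h2 := one_spec.2 _ (sub_pos.2 h1)
    rw [succ_nsmul]
    grind

lemma IsOrbit.zsmul_lt (hσ : IsOrbit σ) (c i : ℤ) : c • one U < σ i := by
  obtain ⟨c₀, hc⟩ := IsSparseModel.exists_lower (U := U)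
  -- Each step of the orbit gains at least `1`; starting more than `c - c₀` steps back, from a point
  -- at least `c₀`, one ends above `c`.
  have h1 := hc _ one_spec _ (hσ.memR (i - ((c - c₀).toNat + 1 : ℕ)))
  have h2 := hσ.add_nsmul_le (i - ((c - c₀).toNat + 1 : ℕ)) ((c - c₀).toNat + 1)
  rw [sub_add_cancel] at h2
  refine lt_of_lt_of_le ?_ ((add_le_add_left h1 _).trans h2)
  rw [← natCast_zsmul, ← add_smul]
  exact zsmul_lt_zsmul_left one_spec.1 (by push_cast; omega)

lemma IsOrbit.pos (hσ : IsOrbit σ) (i : ℤ) : 0 < σ i := by simpa using hσ.zsmul_lt 0 i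

lemma exists_zsmul_le_rMin : ∃ c : ℤ, c • one U ≤ rMin U := by
  obtain ⟨c₀, hc⟩ := IsSparseModel.exists_lower (U := U)
  exact ⟨c₀, hc _ one_spec _ rMin_spec.1⟩

lemma IsOrbit.neg_lt_rMin (hσ : IsOrbit σ) (i : ℤ) : -σ i < rMin U := by
  obtain ⟨c, hc⟩ := exists_zsmul_le_rMin (U := U)
  have := hσ.zsmul_lt (-c) i
  rw [neg_smul] at this
  grind

lemma exists_gap : ∃ k : ℕ, ∀ σ : ℤ → U, IsOrbit σ → ∀ i, σ (i - k) < σ (i + 1) - σ i := by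
  obtain ⟨k, hk⟩ := IsSparseModel.doubling (U := U)
  refine ⟨k, fun σ hσ i => ?_⟩
  have := hk _ (hσ.shift i)
  rwa [neg_add_eq_sub, zero_add, add_comm 1 i] at this

/-- The gap after `σ (i + k)` exceeds `σ i`, and `σ (i + k) ≥ σ i`. This absorbs sums into a shift
along the orbit. -/
lemma exists_double : ∃ D : ℕ, ∀ σ : ℤ → U, IsOrbit σ → ∀ i, σ i + σ i < σ (i + D) := by
  obtain ⟨k, hk⟩ := exists_gap (U := U)
  refine ⟨k + 1, fun σ hσ i => ?_⟩
  have h1 := hk σ hσ (i + k)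
  have h2 := hσ.strictMono.monotone (show i ≤ i + k by omega)
  rw [add_sub_cancel_right] at h1
  rw [show i + (k + 1 : ℕ) = i + k + 1 by push_cast; ring]
  grind

/-- By `exists_double`, the elements bounded by some term of the orbit form a subgroup, and it
contains the orbit. -/
lemma IsOrbit.exists_bound (hσ : IsOrbit σ) (z : ℤ →₀ ℤ) :
    ∃ k : ℤ, |Finsupp.linearCombination ℤ σ z| < σ k := by
  obtain ⟨D, hD⟩ := exists_double (U := U)
  let S : AddSubgroup U :=
    { carrier := {u | ∃ k : ℤ, |u| < σ k}
      zero_mem' := ⟨0, by simpa using hσ.pos 0⟩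
      add_mem' := by
        rintro a b ⟨k, hk⟩ ⟨l, hl⟩
        refine ⟨max k l + D, ?_⟩
        have h1 := hD σ hσ (max k l)
        have h2 := hσ.strictMono.monotone (le_max_left k l)
        have h3 := hσ.strictMono.monotone (le_max_right k l)
        have h4 := abs_add_le a b
        grind
      neg_mem' := by
        rintro a ⟨k, hk⟩
        exact ⟨k, by rwa [abs_neg]⟩ }
  have hS : ∀ i, σ i ∈ S := fun i =>
    ⟨i + 1, by rw [abs_of_pos (hσ.pos i)]; exact hσ.strictMono (by omega)⟩
  change Finsupp.linearCombination ℤ σ z ∈ S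
  rw [Finsupp.linearCombination_apply]
  exact sum_mem fun i _ => zsmul_mem (hS i) _

lemma IsOrbit.exists_lam_eq (hσ : IsOrbit σ) {x : U} {i j : ℤ} (hi : σ i ≤ x) (hj : x < σ j) :
    ∃ t, lam x = σ t := by
  obtain ⟨t, ht, hmax⟩ := Int.exists_greatest_of_bdd (P := fun t => σ t ≤ x)
    ⟨j, fun t ht => (hσ.strictMono.lt_iff_lt.1 (ht.trans_lt hj)).le⟩ ⟨i, hi⟩
  refine ⟨t, lam_eq_of_next (hσ t) ht ?_⟩
  by_contra h
  have := hmax (t + 1) (not_lt.1 h)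
  omega

/-- No element of `R` lies strictly between consecutive terms, so one off the orbit is on the same
side of all of it. -/
lemma IsOrbit.lt_iff_lt (hσ : IsOrbit σ) {x : U} (hx : MemR x) (hne : ∀ i, x ≠ σ i) (i j : ℤ) :
    σ i < x ↔ σ j < x := by
  have step : ∀ i, σ i < x ↔ σ (i + 1) < x := by
    intro i
    have h := (next_iff _ _).1 (hσ i)
    exact ⟨fun h1 => lt_of_le_of_ne (h.2.2.2 x hx h1) (hne _).symm, fun h1 => h.2.2.1.trans h1⟩
  have h0 : ∀ i, σ i < x ↔ σ 0 < x := by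
    intro i
    induction i using Int.induction_on with
    | zero => rfl
    | succ i ih => rw [← step, ih]
    | pred i ih => rw [← ih, step, sub_add_cancel]
  rw [h0 i, h0 j]

end Orbits

/-! ### Adding a pair of orbits to a graph -/

section Systems

variable {U : Type u} [zrLang.Structure U] [AddCommGroup U] [LinearOrder U] [IsOrderedAddMonoid U]
  [IsSparseModel U]

/-- The graph of a partial isomorphism of substructures of `(U; 0, 1, <, +, -, R, λ, S, S⁻¹)` that
preserves congruences. -/
structure Sys (G : AddSubgroup (U × U)) : Prop extends PresSys G where
  lam : ∀ p ∈ G, (lam p.1, lam p.2) ∈ G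
  succ : ∀ p ∈ G, (AlmostSparse.succ p.1, AlmostSparse.succ p.2) ∈ G
  pred : ∀ p ∈ G, (AlmostSparse.pred p.1, AlmostSparse.pred p.2) ∈ G

/-- The restriction of a graph to `R`. -/
def resGraph (G : AddSubgroup (U × U)) : Set (RSet U × RSet U) := {p | (p.1.1, p.2.1) ∈ G}

lemma Sys.swap {G : AddSubgroup (U × U)} (h : Sys G) : Sys (swapGraph G) where
  toPresSys := h.toPresSys.swap
  lam _ hp := h.lam _ hp
  succ _ hp := h.succ _ hp
  pred _ hp := h.pred _ hp

/-- `r₀` is the value of `λ` at any standard integer below it, and standard integers are fixed. -/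
lemma Sys.rMin_mem {G : AddSubgroup (U × U)} (h : Sys G) : (rMin U, rMin U) ∈ G := by
  obtain ⟨c, hc⟩ := exists_zsmul_le_rMin (U := U)
  have h1 := h.lam _ (h.diag_mem (c - 1))
  have h2 : (c - 1) • one U < rMin U := by
    refine lt_of_lt_of_le ?_ hc
    exact zsmul_lt_zsmul_left one_spec.1 (by omega)
  rwa [lam_of_lt _ h2] at h1

lemma Sys.memR_iff {G : AddSubgroup (U × U)} (h : Sys G) {p : U × U} (hp : p ∈ G) :
    MemR p.1 ↔ MemR p.2 := by
  rw [memR_iff_lam_eq, memR_iff_lam_eq]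
  exact h.eq_iff (h.lam p hp) hp

/-- Away from the case `x < r₀`, the inequalities `s ≤ x < S s` characterize `λ x = s`, and `G`
preserves them. Thus it is enough to locate `λ` on the domain side. -/
lemma PresSys.lam_eq {G : AddSubgroup (U × U)} (h : PresSys G) (hr : (rMin U, rMin U) ∈ G)
    {q e : U × U} (hq : q ∈ G) (he : e ∈ G) (he1 : lam q.1 = e.1) (he2 : MemR e.2)
    (hs : (AlmostSparse.succ e.1, AlmostSparse.succ e.2) ∈ G) : lam q.2 = e.2 := by
  rcases lt_or_ge q.1 (rMin U) with hlt | hge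
  · rw [lam_of_lt _ ((h.lt_iff hq hr).1 hlt)]
    rw [lam_of_lt _ hlt] at he1
    exact (h.eq_iff hr he).1 he1
  · have h1 := (lam_spec _ hge).2.1
    have h2 := lt_succ q.1
    rw [← succ_lam, he1] at h2
    rw [he1] at h1
    have h3 := next_succ e.2
    rw [lam_of_memR he2] at h3
    exact lam_eq_of_next h3 ((h.le_iff he hq).1 h1) ((h.lt_iff hq hs).1 h2)

/-- A pair of orbits outside of the domain and the image of `G` that are in the same position. -/
structure OrbitPair (G : AddSubgroup (U × U)) (σ τ : ℤ → U) : Prop where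
  left : IsOrbit σ
  right : IsOrbit τ
  div : ∀ i, ∀ n : ℕ, n ≠ 0 → ∃ y, σ i - τ i = n • y
  lt_iff : ∀ p ∈ G, MemR p.1 → ∀ i, σ i < p.1 ↔ τ i < p.2
  ne_left : ∀ p ∈ G, ∀ i, p.1 ≠ σ i
  ne_right : ∀ p ∈ G, ∀ i, p.2 ≠ τ i

/-- The extension of a graph by a pair of orbits. -/
noncomputable def orbitExt (G : AddSubgroup (U × U)) (σ τ : ℤ → U) : AddSubgroup (U × U) :=
  G ⊔ (LinearMap.range (Finsupp.linearCombination ℤ fun i => (σ i, τ i))).toAddSubgroup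

lemma mem_orbitExt {G : AddSubgroup (U × U)} {σ τ : ℤ → U} {q : U × U} :
    q ∈ orbitExt G σ τ ↔ ∃ d ∈ G, ∃ z : ℤ →₀ ℤ,
      q = (d.1 + Finsupp.linearCombination ℤ σ z, d.2 + Finsupp.linearCombination ℤ τ z) := by
  have h : ∀ z : ℤ →₀ ℤ, Finsupp.linearCombination ℤ (fun i => (σ i, τ i)) z =
      (Finsupp.linearCombination ℤ σ z, Finsupp.linearCombination ℤ τ z) := by
    intro z
    refine Prod.ext ?_ ?_
    · exact Finsupp.apply_linearCombination ℤ (LinearMap.fst ℤ U U) _ z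
    · exact Finsupp.apply_linearCombination ℤ (LinearMap.snd ℤ U U) _ z
  rw [orbitExt, AddSubgroup.mem_sup]
  constructor
  · rintro ⟨d, hd, _, ⟨z, rfl⟩, rfl⟩
    exact ⟨d, hd, z, by rw [h]; rfl⟩
  · rintro ⟨d, hd, z, rfl⟩
    exact ⟨d, hd, _, ⟨z, rfl⟩, by rw [h]; rfl⟩

variable {G : AddSubgroup (U × U)} {σ τ : ℤ → U}

lemma le_orbitExt : G ≤ orbitExt G σ τ := le_sup_left

lemma orbit_mem_orbitExt (i : ℤ) : (σ i, τ i) ∈ orbitExt G σ τ :=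
  mem_orbitExt.2 ⟨0, zero_mem _, Finsupp.single i 1, by simp⟩

/-- The position of `p.1` is that of `λ p.1`, which lies in `R` and off the orbit, hence on one side
of it; `lt_iff` puts the image on the same side. -/
lemma OrbitPair.position_of_nonneg (hG : Sys G) (h : OrbitPair G σ τ) {p : U × U} (hp : p ∈ G) :
    (∀ i, σ i < p.1 ∧ τ i < p.2) ∨ (∀ i, p.1 < σ i ∧ p.2 < τ i) := by
  have hl := hG.lam p hp
  have h1 := h.lt_iff _ hl (memR_lam _)
  have h2 := h.left.lt_iff_lt (memR_lam p.1) (h.ne_left _ hl)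
  have h3 := h.right.lt_iff_lt (memR_lam p.2) (h.ne_right _ hl)
  have big : ∀ {ρ : ℤ → U} {x : U}, IsOrbit ρ → ∀ i, ρ i < lam x → ρ i < x := by
    intro ρ x hρ i hi
    rcases lt_or_ge x (rMin U) with hx | hx
    · rw [lam_of_lt x hx] at hi
      exact absurd (rMin_spec.2 _ (hρ.memR i)) (not_le.2 hi)
    · exact hi.trans_le (lam_spec x hx).2.1
  have small : ∀ {ρ : ℤ → U} {x : U}, IsOrbit ρ → ∀ i, lam x < ρ i → x < ρ i := by
    intro ρ x hρ i hi
    exact (lt_succ x).trans_le (((next_iff _ _).1 (next_succ x)).2.2.2 _ (hρ.memR i) hi)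
  by_cases h0 : σ 0 < lam p.1
  · exact Or.inl fun i => ⟨big h.left i ((h2 0 i).1 h0),
      big h.right i ((h3 0 i).1 ((h1 0).1 h0))⟩
  · refine Or.inr fun i => ⟨small h.left i ?_, small h.right i ?_⟩
    · exact lt_of_le_of_ne (not_lt.1 fun h4 => h0 ((h2 i 0).1 h4)) (h.ne_left _ hl i)
    · exact lt_of_le_of_ne (not_lt.1 fun h4 => h0 ((h1 0).2 ((h3 i 0).1 h4))) (h.ne_right _ hl i)

lemma OrbitPair.position (hG : Sys G) (h : OrbitPair G σ τ) {p : U × U} (hp : p ∈ G) :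
    (∀ i, |p.1| < σ i ∧ |p.2| < τ i) ∨ (∀ i, σ i < p.1 ∧ τ i < p.2) ∨
      (∀ i, p.1 < -σ i ∧ p.2 < -τ i) := by
  rcases h.position_of_nonneg hG hp with h1 | h1
  · exact Or.inr (Or.inl h1)
  rcases h.position_of_nonneg hG (neg_mem hp) with h2 | h2
  · refine Or.inr (Or.inr fun i => ?_)
    have := h2 i
    simp only [Prod.fst_neg, Prod.snd_neg] at this
    exact ⟨lt_neg.1 this.1, lt_neg.1 this.2⟩
  · refine Or.inl fun i => ?_
    have h3 := h1 i
    have h4 := h2 i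
    simp only [Prod.fst_neg, Prod.snd_neg] at h4
    exact ⟨abs_lt.2 ⟨neg_lt.1 h4.1, h3.1⟩, abs_lt.2 ⟨neg_lt.1 h4.2, h3.2⟩⟩

lemma OrbitPair.presSys (hG : Sys G) (h : OrbitPair G σ τ) : PresSys (orbitExt G σ τ) where
  one_mem := le_orbitExt hG.one_mem
  pos := by
    intro q hq
    obtain ⟨d, hd, z, rfl⟩ := mem_orbitExt.1 hq
    obtain ⟨k, hk⟩ := IsSparseModel.trichotomy (U := U) z
    obtain ⟨k₁, hk₁⟩ := h.left.exists_bound z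
    obtain ⟨k₂, hk₂⟩ := h.right.exists_bound z
    have hd0 := hG.pos d hd
    rcases h.position hG hd with h1 | h1 | h1
    · have h2 := h1 (-k)
      rcases hk with hk | hk | hk
      · have h3 := hk σ h.left
        have h4 := hk τ h.right
        exact iff_of_true (by grind) (by grind)
      · have h3 := hk σ h.left
        have h4 := hk τ h.right
        exact iff_of_false (by grind) (by grind)
      · rwa [hk σ h.left, hk τ h.right, add_zero, add_zero]
    · have h2 := h1 k₁
      have h3 := h1 k₂
      exact iff_of_true (by grind) (by grind)
    · have h2 := h1 k₁
      have h3 := h1 k₂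
      exact iff_of_false (by grind) (by grind)
  div := by
    intro q hq n hn
    -- Agreement modulo `n` defines a subgroup, so checking it on generators suffices.
    let S : AddSubgroup (U × U) :=
      AddSubgroup.comap (AddMonoidHom.fst U U - AddMonoidHom.snd U U) (nsmulAddMonoidHom n).range
    have hS : ∀ p : U × U, p ∈ S ↔ ∃ y, p.1 - p.2 = n • y := fun p =>
      ⟨fun ⟨y, hy⟩ => ⟨y, hy.symm⟩, fun ⟨y, hy⟩ => ⟨y, hy.symm⟩⟩
    rw [← hS]
    obtain ⟨d, hd, w, ⟨z, rfl⟩, rfl⟩ := AddSubgroup.mem_sup.1 hq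
    refine add_mem ((hS _).2 (hG.div d hd n hn)) ?_
    rw [Finsupp.linearCombination_apply]
    exact sum_mem fun i _ => zsmul_mem ((hS _).2 (h.div i n hn)) _

/-- For `d` below the orbit, `d + u` is trapped between orbit terms, is below `r₀`, or equals `d`.
For `d` beyond the orbit, `u` is too small to move `λ d` off its own orbit, or out of the region
below `r₀`. -/
lemma OrbitPair.lam_cases (hG : Sys G) (h : OrbitPair G σ τ) {q : U × U}
    (hq : q ∈ orbitExt G σ τ) : (∃ p ∈ G, lam q.1 = p.1) ∨ ∃ t, lam q.1 = σ t := by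
  obtain ⟨d, hd, z, rfl⟩ := mem_orbitExt.1 hq
  obtain ⟨k, hk⟩ := IsSparseModel.trichotomy (U := U) z
  obtain ⟨k₁, hk₁⟩ := h.left.exists_bound z
  obtain ⟨D, hD⟩ := exists_double (U := U)
  have hD := hD σ h.left
  have hpos := h.left.pos
  simp only
  generalize hu : Finsupp.linearCombination ℤ σ z = u at *
  rcases h.position hG hd with h1 | h1 | h1
  · have h1 : ∀ i, |d.1| < σ i := fun i => (h1 i).1
    rcases hk with hk | hk | hk
    · have h3 := hk σ h.left
      rw [hu] at h3
      -- `u > σ (-k) > 2 σ (-k - D)` while `|d| < σ (-k - D)`; above, both `|d|` and `|u|` are below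
      -- `σ k₁`.
      refine Or.inr (h.left.exists_lam_eq (i := -k - D) (j := k₁ + D) ?_ ?_)
      · have h4 := hD (-k - D)
        rw [sub_add_cancel] at h4
        have h5 := h1 (-k - D)
        grind
      · have h4 := hD k₁
        have h5 := h1 k₁
        grind
    · have h3 := hk σ h.left
      rw [hu] at h3
      refine Or.inl ⟨_, hG.rMin_mem, lam_of_lt _ ?_⟩
      have h4 := hD (-k - D)
      rw [sub_add_cancel] at h4
      have h5 := h1 (-k - D)
      have h6 := h.left.neg_lt_rMin (-k - D)
      grind
    · have h3 := hk σ h.left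
      rw [hu] at h3
      rw [h3, add_zero]
      exact Or.inl ⟨_, hG.lam d hd, rfl⟩
  · have h1 : ∀ i, σ i < d.1 := fun i => (h1 i).1
    have hge : rMin U ≤ d.1 := (rMin_spec.2 _ (h.left.memR 0)).trans (h1 0).le
    -- `ρ` is the orbit of `λ d`, inside the old domain and above all of `σ`. Its gaps exceed
    -- earlier terms of `ρ`, hence `|u|`, so `d + u` stays between `ρ (-1)` and `ρ 2`.
    obtain ⟨ρ, hρ0, hρ, hX⟩ := exists_orbit
      (fun x => MemR x ∧ (∀ i, σ i < x) ∧ ∃ p ∈ G, p.1 = x) (by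
        rintro _ ⟨hx, hσx, p, hp, rfl⟩
        have hne : p.1 ≠ rMin U := by
          intro h2
          have := hσx 0
          rw [h2] at this
          exact absurd (rMin_spec.2 _ (h.left.memR 0)) (not_le.2 this)
        have hs := (next_iff _ _).1 (next_succ p.1)
        have hp' := (next_iff _ _).1 (next_pred hx hne)
        refine ⟨hx, hne, ⟨hs.2.1, fun i => (hσx i).trans (lt_succ _), _, hG.succ p hp, rfl⟩,
          hp'.1, fun i => ?_, _, hG.pred p hp, rfl⟩
        refine lt_of_le_of_ne ?_ (h.ne_left _ (hG.pred p hp) i).symm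
        by_contra h2
        exact absurd (hp'.2.2.2 _ (h.left.memR i) (not_le.1 h2)) (not_le.2 (hσx i)))
      (lam d.1) ⟨memR_lam _, fun i => by
        refine lt_of_le_of_ne ((lam_spec _ hge).2.2 _ (h.left.memR i) (h1 i).le)
          (h.ne_left _ (hG.lam d hd) i).symm, _, hG.lam d hd, rfl⟩
    obtain ⟨g, hg⟩ := exists_gap (U := U)
    have h2 := hg ρ hρ (-1)
    have h3 := hg ρ hρ 1
    have h4 := (hX (-1 - g)).2.1 k₁
    have h5 := (hX (1 - g)).2.1 k₁
    have h6 : ρ 0 ≤ d.1 := hρ0 ▸ (lam_spec _ hge).2.1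
    have h7 : d.1 < ρ 1 := by
      have := lt_succ d.1
      rwa [← succ_lam, ← hρ0, (hρ 0).succ_eq, zero_add] at this
    rw [neg_add_cancel] at h2
    obtain ⟨t, ht⟩ := hρ.exists_lam_eq (x := d.1 + u) (i := -1) (j := 1 + 1)
      (by grind) (by grind)
    obtain ⟨p, hp, hpt⟩ := (hX t).2.2
    exact Or.inl ⟨p, hp, ht.trans hpt.symm⟩
  · refine Or.inl ⟨_, hG.rMin_mem, lam_of_lt _ ?_⟩
    have h2 := (h1 (k₁ + D)).1
    have h3 := h.left.neg_lt_rMin k₁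
    have h4 := hD k₁
    grind

lemma OrbitPair.lam_mem (hG : Sys G) (h : OrbitPair G σ τ) {q : U × U}
    (hq : q ∈ orbitExt G σ τ) :
    (lam q.1, lam q.2) ∈ G ∨ ∃ t, (lam q.1, lam q.2) = (σ t, τ t) := by
  have hr := le_orbitExt (σ := σ) (τ := τ) hG.rMin_mem
  rcases h.lam_cases hG hq with ⟨p, hp, hpq⟩ | ⟨t, ht⟩
  · left
    have hpR : MemR p.2 := (hG.memR_iff hp).1 (hpq ▸ memR_lam _)
    rw [(h.presSys hG).lam_eq hr hq (le_orbitExt hp) hpq hpR (le_orbitExt (hG.succ p hp)), hpq]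
    exact hp
  · right
    refine ⟨t, ?_⟩
    rw [(h.presSys hG).lam_eq hr hq (orbit_mem_orbitExt t) ht (h.right.memR t) (by
      simp only
      rw [(h.left t).succ_eq, (h.right t).succ_eq]
      exact orbit_mem_orbitExt _), ht]

lemma OrbitPair.sys (hG : Sys G) (h : OrbitPair G σ τ) : Sys (orbitExt G σ τ) where
  toPresSys := h.presSys hG
  lam q hq := by
    rcases h.lam_mem hG hq with h1 | ⟨t, h1⟩
    · exact le_orbitExt h1
    · exact h1 ▸ orbit_mem_orbitExt t
  succ q hq := by
    rw [← succ_lam q.1, ← succ_lam q.2]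
    rcases h.lam_mem hG hq with h1 | ⟨t, h1⟩
    · exact le_orbitExt (hG.succ _ h1)
    · rw [Prod.mk.injEq] at h1
      rw [h1.1, h1.2, (h.left t).succ_eq, (h.right t).succ_eq]
      exact orbit_mem_orbitExt _
  pred q hq := by
    rw [← pred_lam q.1, ← pred_lam q.2]
    rcases h.lam_mem hG hq with h1 | ⟨t, h1⟩
    · exact le_orbitExt (hG.pred _ h1)
    · have h2 := h.left (t - 1)
      have h3 := h.right (t - 1)
      rw [sub_add_cancel] at h2 h3
      rw [Prod.mk.injEq] at h1
      rw [h1.1, h1.2, h2.pred_eq, h3.pred_eq]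
      exact orbit_mem_orbitExt _

end Systems

/-! ### The extension step -/

section Extension

variable {U : Type u} [zrLang.Structure U] [AddCommGroup U] [LinearOrder U] [IsOrderedAddMonoid U]
  [IsSparseModel U]

lemma Sys.sSup {c : Set (AddSubgroup (U × U))} (hc : IsChain (· ≤ ·) c) (hne : c.Nonempty)
    (h : ∀ G ∈ c, Sys G) : Sys (sSup c) := by
  have hmem : ∀ {p : U × U}, p ∈ SupSet.sSup c ↔ ∃ G ∈ c, p ∈ G :=
    AddSubgroup.mem_sSup_of_directedOn hne hc.directedOn
  refine ⟨⟨?_, ?_, ?_⟩, ?_, ?_, ?_⟩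
  · obtain ⟨G, hG⟩ := hne
    exact hmem.2 ⟨G, hG, (h G hG).one_mem⟩
  · intro p hp
    obtain ⟨G, hG, hpG⟩ := hmem.1 hp
    exact (h G hG).pos p hpG
  · intro p hp
    obtain ⟨G, hG, hpG⟩ := hmem.1 hp
    exact (h G hG).div p hpG
  · intro p hp
    obtain ⟨G, hG, hpG⟩ := hmem.1 hp
    exact hmem.2 ⟨G, hG, (h G hG).lam p hpG⟩
  · intro p hp
    obtain ⟨G, hG, hpG⟩ := hmem.1 hp
    exact hmem.2 ⟨G, hG, (h G hG).succ p hpG⟩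
  · intro p hp
    obtain ⟨G, hG, hpG⟩ := hmem.1 hp
    exact hmem.2 ⟨G, hG, (h G hG).pred p hpG⟩

/-- The domain is closed under `S` and `S⁻¹` and contains `r₀`, so the orbit of an element of `R`
outside it is `ℤ`-indexed and misses it entirely. Its image under `h` is again an orbit, as
succession is preserved. -/
lemma Sys.exists_orbitPair {G : AddSubgroup (U × U)} (hG : Sys G) (N : AddSubgroup U)
    (hNs : ∀ x ∈ N, AlmostSparse.succ x ∈ N) (hNp : ∀ x ∈ N, AlmostSparse.pred x ∈ N)
    {h : Set (RSet U × RSet U)} (he : Elem resLang h) (hGh : resGraph G ⊆ h)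
    (hN : ∀ a : RSet U, a.1 ∈ N → ∃ b, (a, b) ∈ h) (a : U) (ha : MemR a) (haN : a ∈ N)
    (haG : ∀ p ∈ G, p.1 ≠ a) :
    ∃ σ τ : ℤ → U, σ 0 = a ∧ OrbitPair G σ τ ∧ (∀ i, σ i ∈ N) ∧
      ∀ i, ∃ h1 h2, ((⟨σ i, h1⟩, ⟨τ i, h2⟩) : RSet U × RSet U) ∈ h := by
  obtain ⟨σ, hσ0, hσ, hX⟩ := exists_orbit (fun x => MemR x ∧ x ∈ N ∧ ∀ p ∈ G, p.1 ≠ x) (by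
    rintro x ⟨hx, hxN, hxG⟩
    have hne : x ≠ rMin U := (hxG _ hG.rMin_mem).symm
    have hs := next_succ x
    rw [lam_of_memR hx] at hs
    have hp := next_pred hx hne
    refine ⟨hx, hne, ⟨hs.2.1, hNs x hxN, ?_⟩, hp.1, hNp x hxN, ?_⟩
    · rintro p hpG hpx
      exact hxG _ (hG.pred p hpG) (by rw [hpx, hs.pred_eq])
    · rintro p hpG hpx
      exact hxG _ (hG.succ p hpG) (by rw [hpx, hp.succ_eq])) a ⟨ha, haN, haG⟩
  choose t ht using fun i => hN ⟨σ i, hσ.memR i⟩ (hX i).2.1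
  have hres : ∀ p ∈ G, ∀ (h1 : MemR p.1) (h2 : MemR p.2),
      ((⟨p.1, h1⟩, ⟨p.2, h2⟩) : RSet U × RSet U) ∈ h := fun p hp h1 h2 => hGh hp
  refine ⟨σ, fun i => (t i).1, hσ0, ?_, fun i => (hX i).2.1, fun i => ⟨_, (t i).2, ht i⟩⟩
  exact
    { left := hσ
      right := fun i => he.res_next (ht i) (ht (i + 1)) (hσ i)
      div := fun i n hn => he.res_div (ht i) n hn
      lt_iff := fun p hp hpR i =>
        (he.res_lt_iff (ht i) (hres p hp hpR ((hG.memR_iff hp).1 hpR))).symm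
      ne_left := fun p hp i => (hX i).2.2 p hp
      ne_right := by
        intro p hp i hpi
        have hp2 : MemR p.2 := hpi ▸ (t i).2
        have hp1 := (hG.memR_iff hp).2 hp2
        have := (he.eq_iff (hres p hp hp1 hp2) (ht i)).1 (Subtype.ext hpi)
        exact (hX i).2.2 p hp (congrArg Subtype.val this) }

/-- A graph maximal among those inside `N` whose trace on `R` is contained in `h` must cover `N ∩
R`, since otherwise an orbit could be added. -/
lemma Sys.exists_cover {G : AddSubgroup (U × U)} (hG : Sys G) (N : AddSubgroup U)
    (hNs : ∀ x ∈ N, AlmostSparse.succ x ∈ N) (hNp : ∀ x ∈ N, AlmostSparse.pred x ∈ N)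
    (hGN : ∀ p ∈ G, p.1 ∈ N)
    {h : Set (RSet U × RSet U)} (he : Elem resLang h) (hGh : resGraph G ⊆ h)
    (hN : ∀ a : RSet U, a.1 ∈ N → ∃ b, (a, b) ∈ h) :
    ∃ G', G ≤ G' ∧ Sys G' ∧ (∀ p ∈ G', p.1 ∈ N) ∧ resGraph G' ⊆ h ∧
      ∀ a ∈ N, MemR a → ∃ p ∈ G', p.1 = a := by
  obtain ⟨G', hGG', hmax⟩ := zorn_le_nonempty₀
    {G : AddSubgroup (U × U) | Sys G ∧ (∀ p ∈ G, p.1 ∈ N) ∧ resGraph G ⊆ h} (by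
      intro c hc hchain G₀ hG₀
      have hmem : ∀ {p : U × U}, p ∈ SupSet.sSup c ↔ ∃ G ∈ c, p ∈ G :=
        AddSubgroup.mem_sSup_of_directedOn ⟨_, hG₀⟩ hchain.directedOn
      refine ⟨SupSet.sSup c, ⟨Sys.sSup hchain ⟨_, hG₀⟩ fun G hG => (hc hG).1, ?_, ?_⟩,
        fun G hG => le_sSup hG⟩
      · intro p hp
        obtain ⟨G, hG, hpG⟩ := hmem.1 hp
        exact (hc hG).2.1 p hpG
      · intro p hp
        obtain ⟨G, hG, hpG⟩ := hmem.1 hp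
        exact (hc hG).2.2 hpG) G ⟨hG, hGN, hGh⟩
  obtain ⟨hs, hd, hr⟩ := hmax.1
  refine ⟨G', hGG', hs, hd, hr, fun a haN ha => ?_⟩
  by_contra! hne
  obtain ⟨σ, τ, hσ0, hP, hσN, hστ⟩ := hs.exists_orbitPair N hNs hNp he hr hN a ha haN hne
  have hs' := hP.sys hs
  have := hmax.2 (y := orbitExt G' σ τ) ⟨hs', ?_, ?_⟩ le_orbitExt (orbit_mem_orbitExt 0)
  · exact hne _ this hσ0
  · intro q hq
    obtain ⟨d, hdG, z, rfl⟩ := mem_orbitExt.1 hq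
    refine add_mem (hd d hdG) ?_
    rw [Finsupp.linearCombination_apply]
    exact sum_mem fun i _ => zsmul_mem (hσN i) _
  · rintro ⟨x, y⟩ hq
    -- `λ` fixes `R`, so the only new elements of `R` are those of the added orbit, and these pairs
    -- belong to `h`.
    have h1 := hP.lam_mem hs hq
    rw [lam_of_memR x.2, lam_of_memR y.2] at h1
    rcases h1 with h1 | ⟨t, h1⟩
    · exact hr h1
    · obtain ⟨h2, h3, h4⟩ := hστ t
      rw [Prod.mk.injEq] at h1
      have hx : x = ⟨σ t, h2⟩ := Subtype.ext h1.1
      have hy : y = ⟨τ t, h3⟩ := Subtype.ext h1.2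
      rw [hx, hy]
      exact h4

lemma countable_lrFunctions : Countable (Σ n, lrLang.Functions n) := by
  let f : (Σ n, lrLang.Functions n) → ℕ := fun F => match F with
    | ⟨_, LRFunc.zero⟩ => 0
    | ⟨_, LRFunc.one⟩ => 1
    | ⟨_, LRFunc.add⟩ => 2
    | ⟨_, LRFunc.neg⟩ => 3
    | ⟨_, LRFunc.lam⟩ => 4
    | ⟨_, LRFunc.succ⟩ => 5
    | ⟨_, LRFunc.pred⟩ => 6
  refine Function.Injective.countable (f := f) ?_
  rintro ⟨_, _ | _⟩ ⟨_, _ | _⟩ h <;> first | rfl | (exact absurd h (by decide))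

lemma mk_closure_lt {κ : Cardinal.{u}} (hκ : Cardinal.aleph0 < κ) (s : Set U)
    (hs : Cardinal.mk s < κ) : Cardinal.mk (Substructure.closure lrLang s) < κ := by
  have h1 := Substructure.lift_card_closure_le (L := lrLang) (s := s)
  have := countable_lrFunctions
  rw [Cardinal.lift_id'.{0, u}] at h1
  refine h1.trans_lt (max_lt hκ ?_)
  rw [Cardinal.lift_id'.{0, u}]
  refine Cardinal.add_lt_of_lt hκ.le hs (lt_of_le_of_lt ?_ hκ)
  rw [Cardinal.lift_le_aleph0]
  exact Cardinal.mk_le_aleph0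

/-- The additive group of a substructure. -/
def substructureAddSubgroup (N : lrLang.Substructure U) : AddSubgroup U where
  carrier := N
  zero_mem' := by
    have := N.fun_mem LRFunc.zero ![] (by simp)
    rwa [← zero_eq]
  add_mem' := by
    intro a b ha hb
    have := N.fun_mem LRFunc.add ![a, b] (by
      intro i; refine Fin.cases ?_ (fun i => ?_) i <;> simpa)
    rw [← IsGroupModel.add_eq]
    exact this
  neg_mem' := by
    intro a ha
    have := N.fun_mem LRFunc.neg ![a] (by simpa)
    rw [← neg_eq]
    exact this

lemma mk_image_fst_le (G : AddSubgroup (U × U)) :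
    Cardinal.mk (Prod.fst '' (G : Set (U × U))) ≤ Cardinal.mk G := Cardinal.mk_image_le

/-- The extension of a member of the back-and-forth system to a further element. -/
lemma Sys.exists_forth {κ : Cardinal.{u}} (hκ : Cardinal.aleph0 < κ)
    (hsat : IsSaturated zrLang κ U) {G : AddSubgroup (U × U)} (hG : Sys G)
    (hGκ : Cardinal.mk G < κ) (hGr : Elem resLang (resGraph G)) (a : U) :
    ∃ G', G ≤ G' ∧ Sys G' ∧ Cardinal.mk G' < κ ∧ Elem resLang (resGraph G') ∧
      ∃ b, (a, b) ∈ G' := by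
  let N := Substructure.closure lrLang (insert a (Prod.fst '' (G : Set (U × U))))
  have hNκ : Cardinal.mk N < κ := mk_closure_lt hκ _ <| by
    refine Cardinal.mk_insert_le.trans_lt ?_
    exact Cardinal.add_lt_of_lt hκ.le ((mk_image_fst_le G).trans_lt hGκ)
      (Cardinal.one_lt_aleph0.trans hκ)
  have hsub := Substructure.subset_closure (L := lrLang)
    (s := insert a (Prod.fst '' (G : Set (U × U))))
  have haN : a ∈ N := hsub (Set.mem_insert _ _)
  have hGN : ∀ p ∈ G, p.1 ∈ N := fun p hp => hsub (Set.mem_insert_of_mem _ ⟨p, hp, rfl⟩)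
  have hlamN : ∀ x ∈ N, AlmostSparse.lam x ∈ N := fun x hx =>
    N.fun_mem LRFunc.lam ![x] (by simpa)
  let T : Set (RSet U) := {x | x.1 ∈ N}
  have hTκ : Cardinal.mk T < κ :=
    (Cardinal.mk_le_of_injective (f := fun x : T => (⟨x.1.1, x.2⟩ : N)) fun x y hxy =>
      Subtype.ext (Subtype.ext (congrArg (fun z : N => z.1) hxy))).trans_lt hNκ
  obtain ⟨h, hGh, he, hTh⟩ := hGr.exists_total hsat T hTκ fun p hp => hGN _ hp
  obtain ⟨G₁, hGG₁, hG₁, hG₁N, hG₁h, hcov⟩ := hG.exists_cover (substructureAddSubgroup N)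
    (fun x hx => N.fun_mem LRFunc.succ ![x] (by simpa))
    (fun x hx => N.fun_mem LRFunc.pred ![x] (by simpa)) hGN he hGh hTh
  have hG₁κ : Cardinal.mk G₁ < κ := mk_lt_of_functional (h := (G₁ : Set (U × U))) (T := N) hNκ hG₁N
    fun p hp q hq => (hG₁.eq_iff hp hq).1
  obtain ⟨b, hb⟩ := hG₁.toPresSys.exists_forth hsat hG₁κ a
  let G₂ := G₁ ⊔ AddSubgroup.zmultiples (a, b)
  have hle : G₁ ≤ G₂ := le_sup_left
  have hG₂N : ∀ q ∈ G₂, q.1 ∈ substructureAddSubgroup N := by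
    intro q hq
    obtain ⟨d, hd, z, hz, rfl⟩ := AddSubgroup.mem_sup.1 hq
    obtain ⟨m, rfl⟩ := AddSubgroup.mem_zmultiples_iff.1 hz
    exact add_mem (hG₁N d hd) (zsmul_mem (S := AddSubgroup U) haN m)
  -- The domain of `G₂` is inside `N`, whose elements of `R` are all in the domain of `G₁`; adding
  -- `a` therefore creates no new value of `λ`.
  have hlam : ∀ q ∈ G₂, (AlmostSparse.lam q.1, AlmostSparse.lam q.2) ∈ G₁ := by
    intro q hq
    obtain ⟨p, hp, hpq⟩ := hcov (AlmostSparse.lam q.1) (hlamN _ (hG₂N q hq)) (memR_lam _)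
    have hpR : MemR p.2 := (hG₁.memR_iff hp).1 (hpq ▸ memR_lam _)
    rw [hb.lam_eq (hle hG₁.rMin_mem) hq (hle hp) hpq.symm hpR (hle (hG₁.succ p hp)), ← hpq]
    exact hp
  refine ⟨G₂, hGG₁.trans hle, ⟨hb, fun q hq => hle (hlam q hq), fun q hq => ?_, fun q hq => ?_⟩,
    mk_sup_lt hκ.le _ _ hG₁κ (mk_zmultiples_lt hκ _), he.mono ?_, b,
    AddSubgroup.mem_sup_right (AddSubgroup.mem_zmultiples _)⟩
  · rw [← succ_lam q.1, ← succ_lam q.2]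
    exact hle (hG₁.succ _ (hlam q hq))
  · rw [← pred_lam q.1, ← pred_lam q.2]
    exact hle (hG₁.pred _ (hlam q hq))
  · rintro ⟨x, y⟩ hq
    have h1 := hlam _ hq
    rw [lam_of_memR x.2, lam_of_memR y.2] at h1
    exact hG₁h h1

end Extension

/-! ### Partial functions and their graphs -/

section PartialMaps

variable {M N : Type*}

/-- The graph of a partial function. -/
def PartialMap.graph (f : PartialMap M N) : Set (M × N) :=
  {p | ∃ h : p.1 ∈ f.dom, f.toFun ⟨p.1, h⟩ = p.2}

/-- The partial function with a given graph. -/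
noncomputable def PartialMap.ofGraph (G : Set (M × N)) : PartialMap M N where
  dom := Prod.fst '' G
  toFun x := x.2.choose.2

lemma PartialMap.graph_ofGraph {G : Set (M × N)} (hG : ∀ p ∈ G, ∀ q ∈ G, p.1 = q.1 → p.2 = q.2) :
    (PartialMap.ofGraph G).graph = G := by
  ext p
  constructor
  · rintro ⟨h, hp⟩
    have h1 := h.choose_spec
    have : h.choose = p := Prod.ext h1.2 hp
    exact this ▸ h1.1
  · intro hp
    have h : p.1 ∈ Prod.fst '' G := ⟨p, hp, rfl⟩
    exact ⟨h, hG _ h.choose_spec.1 _ hp h.choose_spec.2⟩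

lemma PartialMap.mem_graph (f : PartialMap M N) (x : f.dom) : ((x : M), f.toFun x) ∈ f.graph :=
  ⟨x.2, rfl⟩

lemma PartialMap.expands_of_graph_subset {f g : PartialMap M N} (h : f.graph ⊆ g.graph) :
    g.Expands f :=
  ⟨fun x hx => (h (f.mem_graph ⟨x, hx⟩)).1, fun x => (h (f.mem_graph x)).2⟩

lemma PartialMap.isPartialElementary_iff {L : Language} [L.Structure M] (f : PartialMap M M) :
    f.IsPartialElementary L ↔ Elem L f.graph := by
  constructor
  · intro h n φ x hx
    have := h n φ fun i => ⟨(x i).1, (hx i).1⟩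
    simpa only [fun i => (hx i).2] using this
  · intro h n φ x
    exact h n φ (fun i => ((x i : M), f.toFun (x i))) fun i => f.mem_graph (x i)

lemma PartialMap.isPartialEmbedding_of_graph {L : Language} [L.Structure M] (f : PartialMap M M)
    (hfun : ∀ (n : ℕ) (F : L.Functions n) (x : Fin n → M × M), (∀ i, x i ∈ f.graph) →
      (Structure.funMap F (fun i => (x i).1), Structure.funMap F (fun i => (x i).2)) ∈ f.graph)
    (hrel : ∀ (n : ℕ) (R : L.Relations n) (x : Fin n → M × M), (∀ i, x i ∈ f.graph) →
      (Structure.RelMap R (fun i => (x i).2) ↔ Structure.RelMap R (fun i => (x i).1)))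
    (heq : ∀ p ∈ f.graph, ∀ q ∈ f.graph, p.2 = q.2 ↔ p.1 = q.1) : f.IsPartialEmbedding L where
  injective x y hxy := Subtype.ext ((heq _ (f.mem_graph x) _ (f.mem_graph y)).1 hxy)
  map_rel n R x := hrel n R (fun i => ((x i : M), f.toFun (x i))) fun i => f.mem_graph (x i)
  map_fun n F x y := heq _ (hfun n F (fun i => ((x i : M), f.toFun (x i)))
    fun i => f.mem_graph (x i)) _ (f.mem_graph y)

end PartialMaps

/-! ### The system in terms of graphs, and the conclusion -/

section System

variable {U : Type u} [zrLang.Structure U] [AddCommGroup U] [LinearOrder U] [IsOrderedAddMonoid U]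
  [IsSparseModel U]

/-- The graphs of the members of the back-and-forth system. -/
structure IsSystemGraph (κ : Cardinal.{u}) (G : AddSubgroup (U × U)) : Prop extends Sys G where
  small : Cardinal.mk G < κ
  elem : Elem resLang (resGraph G)

lemma IsSystemGraph.swap {κ : Cardinal.{u}} {G : AddSubgroup (U × U)} (h : IsSystemGraph κ G) :
    IsSystemGraph κ (swapGraph G) where
  toSys := h.toSys.swap
  small := by rw [mk_swapGraph]; exact h.small
  elem := h.elem.swap

lemma Sys.funMap_mem {G : AddSubgroup (U × U)} (h : Sys G) (n : ℕ) (F : lrLang.Functions n)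
    (x : Fin n → U × U) (hx : ∀ i, x i ∈ G) :
    (Structure.funMap F (fun i => (x i).1), Structure.funMap F (fun i => (x i).2)) ∈ G := by
  cases F with
  | zero =>
    change (zero U, zero U) ∈ G
    rw [zero_eq]; exact zero_mem G
  | one => exact h.one_mem
  | add =>
    change (AlmostSparse.add _ _, AlmostSparse.add _ _) ∈ G
    rw [IsGroupModel.add_eq, IsGroupModel.add_eq]
    exact add_mem (hx 0) (hx 1)
  | neg =>
    change (AlmostSparse.neg _, AlmostSparse.neg _) ∈ G
    rw [neg_eq, neg_eq]
    exact neg_mem (hx 0)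
  | lam => exact h.lam _ (hx 0)
  | succ => exact h.succ _ (hx 0)
  | pred => exact h.pred _ (hx 0)

lemma Sys.relMap_iff {G : AddSubgroup (U × U)} (h : Sys G) (n : ℕ) (R : lrLang.Relations n)
    (x : Fin n → U × U) (hx : ∀ i, x i ∈ G) :
    Structure.RelMap R (fun i => (x i).2) ↔ Structure.RelMap R (fun i => (x i).1) := by
  cases R with
  | lt =>
    change Lt _ _ ↔ Lt _ _
    rw [IsGroupModel.lt_iff, IsGroupModel.lt_iff]
    exact (h.lt_iff (hx 0) (hx 1)).symm
  | mem => exact (h.memR_iff (hx 0)).symm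

lemma funMap_mem_zr (G : AddSubgroup (U × U)) (n : ℕ) (F : zrLang.Functions n)
    (x : Fin n → U × U) (hx : ∀ i, x i ∈ G) :
    (Structure.funMap F (fun i => (x i).1), Structure.funMap F (fun i => (x i).2)) ∈ G := by
  cases F with
  | add =>
    have h1 : ∀ v : Fin 2 → U, Structure.funMap (L := zrLang) ZRFunc.add v = v 0 + v 1 := by
      intro v
      rw [← IsGroupModel.add_eq, AlmostSparse.add]
      congr 1
      exact List.ofFn_inj.1 (by simp)
    rw [h1, h1]
    exact add_mem (hx 0) (hx 1)

lemma Sys.relMap_iff_zr {G : AddSubgroup (U × U)} (h : Sys G) (n : ℕ) (R : zrLang.Relations n)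
    (x : Fin n → U × U) (hx : ∀ i, x i ∈ G) :
    Structure.RelMap R (fun i => (x i).2) ↔ Structure.RelMap R (fun i => (x i).1) := by
  cases R with
  | lt =>
    have h1 : ∀ v : Fin 2 → U, Structure.RelMap (L := zrLang) ZRRel.lt v ↔ v 0 < v 1 := by
      intro v
      rw [← IsGroupModel.lt_iff, AlmostSparse.Lt]
      exact iff_of_eq (congrArg _ (List.ofFn_inj.1 (by simp)))
    rw [h1, h1]
    exact (h.lt_iff (hx 0) (hx 1)).symm
  | mem =>
    have h1 : ∀ v : Fin 1 → U, Structure.RelMap (L := zrLang) ZRRel.mem v ↔ MemR (v 0) := by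
      intro v
      rw [AlmostSparse.MemR]
      exact iff_of_eq (congrArg _ (List.ofFn_inj.1 (by simp)))
    rw [h1, h1]
    exact (h.memR_iff (hx 0)).symm

lemma PresSys.functional {G : AddSubgroup (U × U)} (h : PresSys G) :
    ∀ p ∈ (G : Set (U × U)), ∀ q ∈ (G : Set (U × U)), p.1 = q.1 → p.2 = q.2 :=
  fun _ hp _ hq => (h.eq_iff hp hq).1

/-- Elementarity for `(U; <, +)` is not part of `IsSystemGraph`; saturation supplies it through
`PresSys.elem`. -/
lemma IsSystemGraph.inSystem {κ : Cardinal.{u}} (hκ : Cardinal.aleph0 < κ)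
    (hsat : IsSaturated zrLang κ U) {G : AddSubgroup (U × U)} (h : IsSystemGraph κ G)
    {f : PartialMap U U} (hf : f.graph = G) : InSystem κ f where
  small := by
    refine (Cardinal.mk_le_of_injective
      (f := fun x : f.dom => (⟨_, hf ▸ f.mem_graph x⟩ : G)) ?_).trans_lt h.small
    intro x y hxy
    exact Subtype.ext (congrArg (fun p : G => p.1.1) hxy)
  dom_substructure := by
    refine ⟨⟨f.dom, fun {n} F x hx => ?_⟩, rfl⟩
    have h1 := h.funMap_mem n F (fun i => (x i, f.toFun ⟨x i, hx i⟩)) fun i =>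
      hf.le (f.mem_graph ⟨x i, hx i⟩)
    exact (hf.ge h1).1
  isPartialEmbedding := by
    refine f.isPartialEmbedding_of_graph ?_ ?_ ?_ <;> rw [hf]
    · exact h.funMap_mem
    · exact h.relMap_iff
    · exact fun p hp q hq => (h.eq_iff hp hq).symm
  isPartialElementary := by
    rw [PartialMap.isPartialElementary_iff, hf]
    exact h.toPresSys.elem hκ hsat h.small
  restrict := by
    have hg := PartialMap.graph_ofGraph (G := resGraph G) fun p hp q hq hpq =>
      Subtype.ext (h.functional _ hp _ hq (congrArg Subtype.val hpq))
    refine ⟨PartialMap.ofGraph (resGraph G), fun x => ⟨?_, fun hx => ?_⟩, fun x hx => ?_, ?_⟩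
    · rintro ⟨p, hp, rfl⟩
      exact (hf.ge hp).1
    · have h1 := hf.le (f.mem_graph ⟨x.1, hx⟩)
      exact ⟨(x, ⟨_, (h.memR_iff h1).1 x.2⟩), h1, rfl⟩
    · have h1 := hg.le (PartialMap.mem_graph _ x)
      exact (hf.ge h1).2.symm
    · rw [PartialMap.isPartialElementary_iff, hg]
      exact h.elem

lemma InSystem.exists_graph {κ : Cardinal.{u}} {f : PartialMap U U} (hf : InSystem κ f) :
    ∃ G : AddSubgroup (U × U), f.graph = G ∧ IsSystemGraph κ G := by
  obtain ⟨N, hN⟩ := hf.dom_substructure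
  have hfun : ∀ (n : ℕ) (F : lrLang.Functions n) (x : Fin n → U × U), (∀ i, x i ∈ f.graph) →
      (Structure.funMap F (fun i => (x i).1), Structure.funMap F (fun i => (x i).2)) ∈
        f.graph := by
    intro n F x hx
    have h1 : Structure.funMap F (fun i => (x i).1) ∈ f.dom := by
      rw [← hN]
      exact N.fun_mem F _ fun i => by
        have := (hx i).1
        rwa [← hN] at this
    refine ⟨h1, ?_⟩
    have h2 := (hf.isPartialEmbedding.map_fun n F (fun i => ⟨_, (hx i).1⟩) ⟨_, h1⟩).2 rfl
    rw [← h2]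
    simp only [fun i => (hx i).2]
  have hadd : ∀ {p q : U × U}, p ∈ f.graph → q ∈ f.graph → p + q ∈ f.graph := by
    intro p q hp hq
    have := hfun 2 LRFunc.add ![p, q] (by simp [Fin.forall_fin_two, hp, hq])
    change (AlmostSparse.add p.1 q.1, AlmostSparse.add p.2 q.2) ∈ f.graph at this
    rwa [IsGroupModel.add_eq, IsGroupModel.add_eq] at this
  have hunary : ∀ (F : lrLang.Functions 1) {p : U × U}, p ∈ f.graph →
      (Structure.funMap F (fun _ => p.1), Structure.funMap F (fun _ => p.2)) ∈ f.graph :=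
    fun F p hp => hfun 1 F (fun _ => p) fun _ => hp
  let G : AddSubgroup (U × U) :=
    { carrier := f.graph
      zero_mem' := by
        have : (zero U, zero U) ∈ f.graph := hfun 0 LRFunc.zero (fun i => i.elim0) fun i => i.elim0
        rwa [zero_eq] at this
      add_mem' := hadd
      neg_mem' := by
        intro p hp
        have : (AlmostSparse.neg p.1, AlmostSparse.neg p.2) ∈ f.graph := hunary LRFunc.neg hp
        rwa [neg_eq, neg_eq] at this }
  have h1 : (one U, one U) ∈ f.graph := hfun 0 LRFunc.one (fun i => i.elim0) fun i => i.elim0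
  refine ⟨G, rfl, ⟨⟨⟨h1, ?_, ?_⟩, ?_, ?_, ?_⟩, ?_, ?_⟩⟩
  · intro p hp
    have h2 := hf.isPartialEmbedding.map_rel 2 LRRel.lt
      ![⟨(0 : U × U).1, (zero_mem G).1⟩, ⟨p.1, hp.1⟩]
    change Lt (f.toFun ⟨(0 : U × U).1, (zero_mem G).1⟩) (f.toFun ⟨p.1, hp.1⟩) ↔
      Lt (0 : U × U).1 p.1 at h2
    rw [IsGroupModel.lt_iff, IsGroupModel.lt_iff, hp.2, (zero_mem G).2] at h2
    exact h2.symm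
  · exact exists_div_of_elem (f.isPartialElementary_iff.1 hf.isPartialElementary) h1
  · exact fun p hp => hunary LRFunc.lam hp
  · exact fun p hp => hunary LRFunc.succ hp
  · exact fun p hp => hunary LRFunc.pred hp
  · refine mk_lt_of_functional (h := f.graph) (T := f.dom) hf.small (fun p hp => hp.1) ?_
    rintro ⟨x, y⟩ ⟨hp, hp'⟩ ⟨x', y'⟩ ⟨hq, hq'⟩ rfl
    exact hp'.symm.trans hq'
  · obtain ⟨g, hg1, hg2, hg3⟩ := hf.restrict
    rw [PartialMap.isPartialElementary_iff] at hg3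
    refine hg3.mono ?_
    rintro ⟨x, y⟩ ⟨hx, hxy⟩
    have hxg := (hg1 x).2 hx
    exact ⟨hxg, Subtype.ext ((hg2 ⟨x, hxg⟩ hx).trans hxy)⟩

/-- The identity on the substructure generated by the empty set, which is countable. -/
lemma exists_isSystemGraph {κ : Cardinal.{u}} (hκ : Cardinal.aleph0 < κ) :
    ∃ G : AddSubgroup (U × U), IsSystemGraph κ G := by
  let N := Substructure.closure lrLang (∅ : Set U)
  have hNκ : Cardinal.mk N < κ := mk_closure_lt hκ _ (by
    rw [Cardinal.mk_eq_zero]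
    exact Cardinal.aleph0_pos.trans hκ)
  let G : AddSubgroup (U × U) := (substructureAddSubgroup N).map
    ((AddMonoidHom.id U).prod (AddMonoidHom.id U))
  have hG : ∀ p, p ∈ G ↔ ∃ x ∈ N, (x, x) = p := fun p => AddSubgroup.mem_map
  have hunary : ∀ F : lrLang.Functions 1, ∀ p ∈ G,
      (Structure.funMap F (fun _ => p.1), Structure.funMap F (fun _ => p.2)) ∈ G := by
    intro F p hp
    obtain ⟨x, hx, rfl⟩ := (hG p).1 hp
    exact (hG _).2 ⟨_, N.fun_mem F _ fun _ => hx, rfl⟩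
  refine ⟨G, ⟨⟨⟨?_, ?_, ?_⟩, ?_, ?_, ?_⟩, ?_, ?_⟩⟩
  · exact (hG _).2 ⟨_, N.fun_mem LRFunc.one (fun i => i.elim0) fun i => i.elim0, rfl⟩
  · intro p hp
    obtain ⟨x, hx, rfl⟩ := (hG p).1 hp
    rfl
  · intro p hp n hn
    obtain ⟨x, hx, rfl⟩ := (hG p).1 hp
    exact ⟨0, by simp⟩
  · exact fun p hp => hunary LRFunc.lam p hp
  · exact fun p hp => hunary LRFunc.succ p hp
  · exact fun p hp => hunary LRFunc.pred p hp
  · refine mk_lt_of_functional (h := (G : Set (U × U))) (T := (N : Set U)) hNκ ?_ ?_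
    · intro p hp
      obtain ⟨x, hx, rfl⟩ := (hG p).1 hp
      exact hx
    · intro p hp q hq
      obtain ⟨x, hx, rfl⟩ := (hG p).1 hp
      obtain ⟨y, hy, rfl⟩ := (hG q).1 hq
      exact id
  · intro n φ x hx
    have : ∀ i, (x i).2 = (x i).1 := by
      intro i
      obtain ⟨y, -, hy⟩ := (hG _).1 (hx i)
      rw [Prod.mk.injEq] at hy
      exact Subtype.ext (hy.2.symm.trans hy.1)
    simp only [this]

lemma IsSystemGraph.exists_forth {κ : Cardinal.{u}} (hκ : Cardinal.aleph0 < κ)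
    (hsat : IsSaturated zrLang κ U) {G : AddSubgroup (U × U)} (h : IsSystemGraph κ G) (a : U) :
    ∃ G', IsSystemGraph κ G' ∧ G ≤ G' ∧ ∃ b, (a, b) ∈ G' := by
  obtain ⟨G', h1, h2, h3, h4, h5⟩ := h.toSys.exists_forth hκ hsat h.small h.elem a
  exact ⟨G', ⟨h2, h3, h4⟩, h1, h5⟩

lemma IsSystemGraph.exists_back {κ : Cardinal.{u}} (hκ : Cardinal.aleph0 < κ)
    (hsat : IsSaturated zrLang κ U) {G : AddSubgroup (U × U)} (h : IsSystemGraph κ G) (b : U) :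
    ∃ G', IsSystemGraph κ G' ∧ G ≤ G' ∧ ∃ a, (a, b) ∈ G' := by
  obtain ⟨G', h1, h2, a, h3⟩ := h.swap.exists_forth hκ hsat b
  exact ⟨swapGraph G', h1.swap, fun p hp => h2 hp, a, h3⟩

lemma IsSystemGraph.elem_zr {κ : Cardinal.{u}} (hκ : Cardinal.aleph0 < κ)
    (hsat : IsSaturated zrLang κ U) {G : AddSubgroup (U × U)} (h : IsSystemGraph κ G) :
    Elem zrLang (G : Set (U × U)) := by
  refine elem_of_backAndForth
    {S | ∃ G : AddSubgroup (U × U), IsSystemGraph κ G ∧ (G : Set (U × U)) = S}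
    ?_ ?_ ?_ ?_ ?_ _ ⟨G, h, rfl⟩
  · rintro _ ⟨G, h, rfl⟩
    exact funMap_mem_zr G
  · rintro _ ⟨G, h, rfl⟩
    exact h.relMap_iff_zr
  · rintro _ ⟨G, h, rfl⟩ p hp q hq
    exact (h.eq_iff hp hq).symm
  · rintro _ ⟨G, h, rfl⟩ a
    obtain ⟨G', h1, h2, h3⟩ := h.exists_forth hκ hsat a
    exact ⟨G', ⟨G', h1, rfl⟩, h2, h3⟩
  · rintro _ ⟨G, h, rfl⟩ b
    obtain ⟨G', h1, h2, h3⟩ := h.exists_back hκ hsat b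
    exact ⟨G', ⟨G', h1, rfl⟩, h2, h3⟩

theorem isBackAndForthSystem_system {κ : Cardinal.{u}} (hκ : Cardinal.aleph0 < κ)
    (hsat : IsSaturated zrLang κ U) :
    IsBackAndForthSystem zrLang (system U κ) ∧ ∀ f ∈ system U κ, f.IsPartialElementary zrLang := by
  have hext : ∀ {f : PartialMap U U} {G G' : AddSubgroup (U × U)}, f.graph = G → G ≤ G' →
      IsSystemGraph κ G' → ∃ g ∈ system U κ, g.Expands f ∧ g.graph = G' := by
    intro f G G' hf hGG' h
    have hg := PartialMap.graph_ofGraph h.functional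
    exact ⟨PartialMap.ofGraph G', h.inSystem hκ hsat hg,
      PartialMap.expands_of_graph_subset (by rw [hf, hg]; exact hGG'), hg⟩
  refine ⟨⟨?_, ?_, ?_, ?_⟩, ?_⟩
  · obtain ⟨G, h⟩ := exists_isSystemGraph (U := U) hκ
    exact ⟨_, h.inSystem hκ hsat (PartialMap.graph_ofGraph h.functional)⟩
  · intro f hf
    obtain ⟨G, hfG, h⟩ := InSystem.exists_graph hf
    refine f.isPartialEmbedding_of_graph ?_ ?_ ?_ <;> rw [hfG]
    · exact funMap_mem_zr G
    · exact h.relMap_iff_zr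
    · exact fun p hp q hq => (h.eq_iff hp hq).symm
  · intro a f hf
    obtain ⟨G, hfG, h⟩ := InSystem.exists_graph hf
    obtain ⟨G', h', hGG', b, hb⟩ := h.exists_forth hκ hsat a
    obtain ⟨g, hg, hgf, hgG'⟩ := hext hfG hGG' h'
    exact ⟨g, hg, hgf, (hgG'.ge hb).1⟩
  · intro b f hf
    obtain ⟨G, hfG, h⟩ := InSystem.exists_graph hf
    obtain ⟨G', h', hGG', a, ha⟩ := h.exists_back hκ hsat b
    obtain ⟨g, hg, hgf, hgG'⟩ := hext hfG hGG' h'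
    have := hgG'.ge ha
    exact ⟨g, hg, hgf, ⟨a, this.1⟩, this.2⟩
  · intro f hf
    obtain ⟨G, hfG, h⟩ := InSystem.exists_graph hf
    rw [PartialMap.isPartialElementary_iff, hfG]
    exact h.elem_zr hκ hsat

end System

end AlmostSparse

theorem mainTheorem7 (r : ℕ → ℤ) (hr : AlmostSparse.IsAlmostSparse r)
    (U : Type u) [AlmostSparse.zrLang.Structure U] [Nonempty U]
    (hU : U ⊨ AlmostSparse.zrTheory r)
    (κ : Cardinal.{u}) (hκ : Cardinal.aleph0 < κ)
    (hsat : AlmostSparse.IsSaturated AlmostSparse.zrLang κ U) :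
    AlmostSparse.IsBackAndForthSystem AlmostSparse.zrLang (AlmostSparse.system U κ) ∧
      ∀ f ∈ AlmostSparse.system U κ, f.IsPartialElementary AlmostSparse.zrLang := by
  let _ := AlmostSparse.addCommGroupOfModel hU
  let _ := AlmostSparse.linearOrderOfModel hU
  have := AlmostSparse.isOrderedAddMonoid_of_model hU
  have := AlmostSparse.isGroupModel_of_model hU
  have := AlmostSparse.isSparseModel hU hr
  exact AlmostSparse.isBackAndForthSystem_system hκ hsat
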